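/- Let $n\ge 1$ and $[n]=\{1,\dots,n\}$. An NTU game assigns to every nonempty $S\subseteq[n]$ a closed, nonempty, proper subset $V(S)\subset\mathbb R^S$ that is comprehensive ($x\in V(S)$, $y\le x$ imply $y\in V(S)$) and bounded in the following sense: there is $M\in\mathbb R$ such that every $x\in V(S)$ with $x_i\ge\sup V(\{i\})$ for all $i\in S$ satisfies $x_i<M$ for all $i\in S$ (if $V(\{i\})=(-\infty,0]$ for all $i$: $x\in V(S)$ and $x\ge0$ imply $x_i<M$). Put $U(S)=V(S)\times\mathbb R^{[n]\setminus S}$, $v_S=\mathbf 1_S/|S|$ and $r=\mathbf 1_{[n]}/n$. A set $\mathcal S$ of nonempty coalitions is $r$-balanced if $\sum_{S\in\mathcal S}\lambda_Sv_S=r$ for some weights $\lambda_S\ge0$; the fractional core of $(U,\{v_S\},r)$ is the set of $x\in\mathbb R^n$ that lie in no $\operatorname{int}U(S)$ and for which there are such $\mathcal S$ and $\lambda$ with $x\in U(S)$ whenever $\lambda_S>0$. The fractional core of the NTU game is defined in the same way with the condition $\sum_{S\in\mathcal S}\lambda_S\mathbf 1_S=\mathbf 1_{[n]}$ in place of $\sum_{S\in\mathcal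 S}\lambda_Sv_S=r$. Let $\tau(x)=\sup\{t: x+t\mathbf 1_{[n]}\in\bigcup_SU(S)\}$ and $F_S=\{x\in\mathbb R^n: x+\tau(x)\mathbf 1_{[n]}\in U(S)\}$. For $M>0$ let $M\Delta=\operatorname{conv}(-Me_1,\dots,-Me_n)$, with faces $\Delta_T=\operatorname{conv}\{-Me_i:i\in T\}$. Let $(V,r)$ be a pair consisting of a finite family $V=\{v_i\}$ of points of some $\mathbb R^d$ and a point $r\in\mathbb R^d$, and let $F=\{F_i\}$ be a closed cover of a compact space $X$. A map associated with $F$ and $(V,r)$ is a map $x\mapsto(\sum_i\varphi_i(x)v_i-r)/\|\sum_i\varphi_i(x)v_i-r\|$ from $X$ to the unit sphere of the direction space of the affine span of $V$, where $\{\varphi_i\}$ is a partition of unity subordinate to an open cover that contains $F$ and has the same nonempty intersections. The cover is homotopically nontrivial with respect to $(V,r)$ if some intersection $\bigcap_{i\in\mathcal S}F_i$ with $r\in\operatorname{conv}\{v_i:i\in\mathcal S\}$ is nonempty, or some associated map is not nullhomotopic. If $X$ is a sphere of the same dimension as the target, with a fixed identification with it, then $\deg F=k\in\mathbb Z$ means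 that there is no such nonempty intersection and that the associated maps (which exist) all have degree $k$. Then the following hold. 1. For all sufficiently large $M$: $\{F_S\}$ is a KKMS cover of $M\Delta$, i.e. the sets $F_S\cap M\Delta$ are closed and $\Delta_T\subseteq\bigcup_{\emptyset\ne S\subseteq T}F_S$ for every nonempty $T\subseteq[n]$; if $n\ge2$, then $\deg(F|_{\partial(M\Delta)})=1$, where $\partial(M\Delta)$ is identified with the sphere of directions by $-Me_i\mapsto e_i$ (affinely on faces) followed by radial projection from $r$; and there is an $r$-balanced $\mathcal S$ such that $\bigcap_{S\in\mathcal S}F_S$ meets $M\Delta$. 2. The triple $(U,\{v_S\},r)$ is a generalized NTU game (the sets $U(S)$ are closed, nonempty, proper and comprehensive, the coordinate sum of each $v_S$ is positive, and $0\ne r\in\operatorname{cone}\{v_S\}$). The pair $(\{v_S\},r)$ is convex, i.e. $\mathcal S$ is $r$-balanced if and only if $r\in\operatorname{conv}\{v_S:S\in\mathcal S\}$. The game is homotopically nontrivial, i.e. there is a generalized game with the same index set, the same sets $F_S$ and the same balanced sets, with a convex pair $(V',r')$, for which some continuous map $f$ from a ball $B^k$, $k\ge1$, to $\{x\in\mathbb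 R^n:\sum_ix_i=0\}$ pulls $\{F_S\}$ back to a cover whose restriction to $S^{k-1}$ is homotopically nontrivial with respect to $(V',r')$. 3. The fractional core of $(U,\{v_S\},r)$ is nonempty and equals the fractional core of the NTU game. 4. (Scarf) If the NTU game is balanced, i.e. $\bigcap_{S\in\Phi}U(S)\subseteq V([n])$ for every family $\Phi$ with weights $\lambda_S\ge0$ such that $\sum_{S\in\Phi}\lambda_S\mathbf 1_S=\mathbf 1_{[n]}$, then its core $V([n])\setminus\bigcup_S\operatorname{int}U(S)$ is nonempty. -/

import Mathlib

open Set Metric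

noncomputable section

namespace ScarfGame

/-! ### Classical cooperative games with non-transferable utility -/

/-- Nonempty coalitions of the player set `{1, …, n}`. -/
abbrev Coalition (n : ℕ) : Type := {S : Finset (Fin n) // S.Nonempty}

/-- The one-player coalition. -/
def single {n : ℕ} (i : Fin n) : Coalition n := ⟨{i}, Finset.singleton_nonempty i⟩

/-- The grand coalition. -/
def grand {n : ℕ} (hn : 0 < n) : Coalition n := ⟨Finset.univ, ⟨⟨0, hn⟩, Finset.mem_univ _⟩⟩

/-- An NTU game: `V S` is the set of payoff vectors in `ℝ^S` feasible for the coalition `S`.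
Boundedness concerns the individually rational payoff vectors, those giving each member `i` at
least as much as `i` can get alone. When `V {i} = (-∞, 0]` for all `i`, it says: there is an `M`
such that `x ∈ V S` and `x ≥ 0` imply `x i < M`. -/
structure NTUGame (n : ℕ) where
  V : (S : Coalition n) → Set (S.1 → ℝ)
  closed : ∀ S, IsClosed (V S)
  nonempty : ∀ S, (V S).Nonempty
  proper : ∀ S, V S ≠ univ
  comprehensive : ∀ S, ∀ x ∈ V S, ∀ y, y ≤ x → y ∈ V S
  bounded : ∀ S, ∃ M : ℝ, ∀ x ∈ V S,
    (∀ i : S.1, ∀ y ∈ V (single i.1), ∀ j, y j ≤ x i) → ∀ i, x i < M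

namespace NTUGame

variable {n : ℕ} (N : NTUGame n)

/-- The cylinder `U(S) = V(S) × ℝ^{[n] ∖ S}`. -/
def U (S : Coalition n) : Set (Fin n → ℝ) := {x | (fun i : S.1 => x i) ∈ N.V S}

end NTUGame

/-- `lam` is a system of balancing weights of the family `Φ` of coalitions:
`∑_{S ∈ Φ} lam_S 1_S = 1_[n]`. -/
def IsBalancingWeights {n : ℕ} (Φ : Finset (Coalition n)) (lam : Coalition n → ℝ) : Prop :=
  (∀ S ∈ Φ, 0 ≤ lam S) ∧ ∑ S ∈ Φ, lam S • (S.1 : Set (Fin n)).indicator (1 : Fin n → ℝ) = 1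

/-- Balanced families of coalitions. -/
def IsBalancedFamily {n : ℕ} (Φ : Finset (Coalition n)) : Prop :=
  ∃ lam, IsBalancingWeights Φ lam

namespace NTUGame

variable {n : ℕ} (N : NTUGame n)

/-- The core: feasible for the grand coalition and not rejected by any coalition. -/
def core (hn : 0 < n) : Set (Fin n → ℝ) := N.U (grand hn) \ ⋃ S, interior (N.U S)

/-- A balanced NTU game. -/
def IsBalanced (hn : 0 < n) : Prop :=
  ∀ Φ : Finset (Coalition n), IsBalancedFamily Φ → (⋂ S ∈ Φ, N.U S) ⊆ N.U (grand hn)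

/-- The fractional core of an NTU game. -/
def fractionalCore : Set (Fin n → ℝ) :=
  {x | (∃ Φ lam, IsBalancingWeights Φ lam ∧ ∀ S ∈ Φ, 0 < lam S → x ∈ N.U S) ∧
    ∀ S, x ∉ interior (N.U S)}

end NTUGame

/-! ### Balanced sets of firms -/

section Balanced

variable {ι : Type} [Fintype ι] {d : ℕ}

/-- `∑_{i ∈ S} lam_i v_i = r` with nonnegative weights. -/
def IsWeights (v : ι → EuclideanSpace ℝ (Fin d)) (r : EuclideanSpace ℝ (Fin d))
    (S : Finset ι) (lam : ι → ℝ) : Prop :=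
  (∀ i ∈ S, 0 ≤ lam i) ∧ ∑ i ∈ S, lam i • v i = r

/-- `S ∈ BS(V, r)`. -/
def IsRBalanced (v : ι → EuclideanSpace ℝ (Fin d)) (r : EuclideanSpace ℝ (Fin d))
    (S : Finset ι) : Prop :=
  ∃ lam, IsWeights v r S lam

/-- `S ∈ conv BS(V, r)`. -/
def IsConvRBalanced (v : ι → EuclideanSpace ℝ (Fin d)) (r : EuclideanSpace ℝ (Fin d))
    (S : Finset ι) : Prop :=
  r ∈ convexHull ℝ (v '' S)

/-- A pair `(V, r)` is convex if `BS(V, r) = conv BS(V, r)`. -/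
def IsConvexPair (v : ι → EuclideanSpace ℝ (Fin d)) (r : EuclideanSpace ℝ (Fin d)) : Prop :=
  ∀ S : Finset ι, IsRBalanced v r S ↔ IsConvRBalanced v r S

end Balanced

/-! ### Homotopy invariants of covers -/

section Covers

variable {ι : Type} [Fintype ι] {d : ℕ} {X : Type} [TopologicalSpace X]

/-- The unit sphere of the direction space of the affine span of `V`, i.e. the target of the maps
associated with covers (as a sphere of dimension `dim aff(V) - 1`, centred at the origin). -/
def dirSphere (v : ι → EuclideanSpace ℝ (Fin d)) : Set (EuclideanSpace ℝ (Fin d)) :=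
  {y | y ∈ vectorSpan ℝ (range v) ∧ ‖y‖ = 1}

/-- There is a convex `r`-balanced set `S` with `⋂_{i ∈ S} F i ≠ ∅`. -/
def HasBalancedIntersection (F : ι → Set X) (v : ι → EuclideanSpace ℝ (Fin d))
    (r : EuclideanSpace ℝ (Fin d)) : Prop :=
  ∃ S : Finset ι, IsConvRBalanced v r S ∧ (⋂ i ∈ S, F i).Nonempty

/-- `g` is a map `x ↦ (∑ φ_i(x) v_i - r) / ‖∑ φ_i(x) v_i - r‖` associated with the closed cover
`F`, where `φ` is a partition of unity subordinate to an open cover `W` that contains `F` and has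
the same pattern of nonempty intersections as `F`. As `g` takes values in the unit sphere, the
denominator vanishes nowhere. -/
def IsCoverMap (F : ι → Set X) (v : ι → EuclideanSpace ℝ (Fin d))
    (r : EuclideanSpace ℝ (Fin d)) (g : C(X, dirSphere v)) : Prop :=
  ∃ (W : ι → Set X) (φ : PartitionOfUnity ι X),
    (∀ i, IsOpen (W i)) ∧ (∀ i, F i ⊆ W i) ∧
    (∀ S : Finset ι, (⋂ i ∈ S, F i).Nonempty ↔ (⋂ i ∈ S, W i).Nonempty) ∧
    φ.IsSubordinate W ∧
    ∀ x, (g x : EuclideanSpace ℝ (Fin d)) =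
      ‖∑ i, φ i x • v i - r‖⁻¹ • (∑ i, φ i x • v i - r)

/-- `[F_{(V,r)}] ≠ 0` for a closed cover `F` of a compact space. -/
def IsNontrivialCover (F : ι → Set X) (v : ι → EuclideanSpace ℝ (Fin d))
    (r : EuclideanSpace ℝ (Fin d)) : Prop :=
  HasBalancedIntersection F v r ∨
    ∃ g : C(X, dirSphere v), IsCoverMap F v r g ∧ ¬ g.Nullhomotopic

/-- The map induced on the `m`-th integral singular homology. -/
def homologyMap {Y : Type} [TopologicalSpace Y] (m : ℕ) (f : C(X, Y)) :=
  ((((AlgebraicTopology.singularHomologyFunctor (ModuleCat.{0} ℤ) m).obj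
    (ModuleCat.of ℤ ℤ)).map (TopCat.ofHom f)).hom)

/-- The degree of `f : X → Y`, where `X` and `Y` are `m`-spheres oriented compatibly with the
homeomorphism `e : X → Y`, is `k`: one has `f_* = k e_*` on the reduced homology
`ker (H_m(X) → H_m(point))`. -/
def HasDegree {Y : Type} [TopologicalSpace Y] (e f : C(X, Y)) (m : ℕ) (k : ℤ) : Prop :=
  ∀ z, homologyMap m (ContinuousMap.const X ()) z = 0 →
    homologyMap m f z = k • homologyMap m e z

/-- `deg F_{(V,r)} = k` for a closed cover `F` of an `m`-sphere `X` that is identified with the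
sphere of directions by `e`: there is no balanced intersection (the degree is not `∞`), and every
map associated with `F` (of which there is at least one) has degree `k`. -/
def HasCoverDegree (F : ι → Set X) (v : ι → EuclideanSpace ℝ (Fin d))
    (r : EuclideanSpace ℝ (Fin d)) (e : C(X, dirSphere v)) (m : ℕ) (k : ℤ) : Prop :=
  ¬ HasBalancedIntersection F v r ∧ (∃ g, IsCoverMap F v r g) ∧
    ∀ g, IsCoverMap F v r g → HasDegree e g m k

end Covers

/-! ### Generalized games -/

/-- A generalized NTU cooperative game with external relations `(U, V, r)`: firms `v i ∈ ℝ^d`,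
allocations in `ℝ^n`, resource vector `r`. -/
structure GenGame (ι : Type) [Fintype ι] (n d : ℕ) where
  U : ι → Set (Fin n → ℝ)
  v : ι → EuclideanSpace ℝ (Fin d)
  r : EuclideanSpace ℝ (Fin d)
  closed : ∀ i, IsClosed (U i)
  nonempty : ∀ i, (U i).Nonempty
  proper : ∀ i, U i ≠ univ
  comprehensive : ∀ i, ∀ x ∈ U i, ∀ y, y ≤ x → y ∈ U i
  firm_pos : ∀ i, 0 < ∑ j, v i j
  r_ne_zero : r ≠ 0
  r_mem_cone : ∃ lam : ι → ℝ, (∀ i, 0 ≤ lam i) ∧ ∑ i, lam i • v i = r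

namespace GenGame

variable {ι : Type} [Fintype ι] {n d : ℕ} (G : GenGame ι n d)

/-- The fractional core. -/
def fractionalCore : Set (Fin n → ℝ) :=
  {x | (∃ S lam, IsWeights G.v G.r S lam ∧ ∀ i ∈ S, 0 < lam i → x ∈ G.U i) ∧
    ∀ i, x ∉ interior (G.U i)}

/-- `τ(x) = sup {t | x + t 1 ∈ ⋃ U_i}`. -/
def tau (x : Fin n → ℝ) : ℝ := sSup {t : ℝ | x + t • 1 ∈ ⋃ i, G.U i}

/-- The induced cover `F(U_i) = {x | x + τ(x) 1 ∈ U_i}`. -/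
def cover (i : ι) : Set (Fin n → ℝ) := {x | x + G.tau x • 1 ∈ G.U i}

/-- Equivalence of games: same induced cover and corresponding balanced sets. -/
def Equivalent {d' : ℕ} (G' : GenGame ι n d') : Prop :=
  (∀ i, G.cover i = G'.cover i) ∧
    ∀ S : Finset ι, IsRBalanced G.v G.r S ↔ IsRBalanced G'.v G'.r S

/-- The induced cover of the hyperplane `H₀ = {x | ∑ x_i = 0}` is homotopically nontrivial with
respect to `(V, r)`: some map `f : B^k → H₀`, `k ≥ 1`, pulls it back to a cover of the ball whose
restriction to the boundary sphere is homotopically nontrivial. -/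
def CoverNontrivial : Prop :=
  ∃ (k : ℕ) (f : C(closedBall (0 : EuclideanSpace ℝ (Fin k)) 1,
      {x : Fin n → ℝ // ∑ i, x i = 0})), 1 ≤ k ∧
    IsNontrivialCover
      (fun i => {x : sphere (0 : EuclideanSpace ℝ (Fin k)) 1 |
        (f ⟨x, sphere_subset_closedBall x.2⟩ : Fin n → ℝ) ∈ G.cover i}) G.v G.r

/-- Homotopical nontriviality of a game. -/
def HomotopicallyNontrivial : Prop :=
  ∃ (d' : ℕ) (G' : GenGame ι n d'), G.Equivalent G' ∧ IsConvexPair G'.v G'.r ∧ G'.CoverNontrivial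

end GenGame

/-! ### The generalized game attached to an NTU game -/

/-- The firm `v_S = 1_S / |S|`. -/
def firm {n : ℕ} (S : Coalition n) : EuclideanSpace ℝ (Fin n) :=
  WithLp.toLp 2 fun i => if i ∈ S.1 then (S.1.card : ℝ)⁻¹ else 0

/-- The barycenter `r = 1_[n] / n`. -/
def bary (n : ℕ) : EuclideanSpace ℝ (Fin n) := WithLp.toLp 2 fun _ => (n : ℝ)⁻¹

lemma firm_grand {n : ℕ} (hn : 0 < n) : firm (grand hn) = bary n := by
  ext i
  simp [firm, bary, grand]

lemma firm_single {n : ℕ} (i : Fin n) : firm (single i) = EuclideanSpace.single i (1 : ℝ) := by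
  ext j
  simp [firm, single]

/-- The generalized game `(U, {1_S / |S|}, 1_[n] / n)` attached to an NTU game. -/
def NTUGame.toGen {n : ℕ} (hn : 0 < n) (N : NTUGame n) : GenGame (Coalition n) n n where
  U := N.U
  v := firm
  r := bary n
  closed S := (N.closed S).preimage (by fun_prop)
  nonempty S := by
    obtain ⟨y, hy⟩ := N.nonempty S
    refine ⟨fun i => if h : i ∈ S.1 then y ⟨i, h⟩ else 0, ?_⟩
    simpa [NTUGame.U] using hy
  proper S h := by
    apply N.proper S
    refine eq_univ_of_forall fun y => ?_
    have : (fun i => if h : i ∈ S.1 then y ⟨i, h⟩ else 0) ∈ N.U S := by rw [h]; trivial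
    simpa [NTUGame.U] using this
  comprehensive S x hx y hy := N.comprehensive S _ hx _ fun i => hy i
  firm_pos S := by
    have : 0 < S.1.card := Finset.card_pos.2 S.2
    have h : ∑ j, firm S j = 1 := by
      simp [firm, Finset.sum_ite_mem]
      field_simp
    rw [h]; exact one_pos
  r_ne_zero h := by
    have := congrArg (fun x : EuclideanSpace ℝ (Fin n) => x ⟨0, hn⟩) h
    simp [bary] at this
    omega
  r_mem_cone := by
    classical
    refine ⟨Pi.single (grand hn) 1, fun i => ?_, ?_⟩
    · by_cases h : i = grand hn
      · subst h; simp
      · simp [h]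
    · simp [Pi.single_apply, firm_grand]

/-! ### The large simplex -/

/-- The face `conv {-M e_i | i ∈ T}` of the scaled simplex. -/
def face {n : ℕ} (M : ℝ) (T : Finset (Fin n)) : Set (Fin n → ℝ) :=
  convexHull ℝ ((fun i => Pi.single i (-M)) '' (T : Set (Fin n)))

/-- The scaled simplex `MΔ = conv {-M e_1, …, -M e_n}`. -/
def simplex (n : ℕ) (M : ℝ) : Set (Fin n → ℝ) := face M Finset.univ

/-- The boundary of the scaled simplex: the union of its proper faces. -/
def boundary (n : ℕ) (M : ℝ) : Set (Fin n → ℝ) :=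
  ⋃ T : {T : Finset (Fin n) // T ≠ Finset.univ}, face M T.1

/-- A family `F`, restricted to the scaled simplex, is a KKMS cover of it: its members are closed
there and every face `Δ_T` is covered by the `F_S` with `S ⊆ T`. -/
def IsKKMSCover {n : ℕ} (M : ℝ) (F : Coalition n → Set (Fin n → ℝ)) : Prop :=
  (∀ S, IsClosed (F S ∩ simplex n M)) ∧
    ∀ T : Coalition n, face M T.1 ⊆ ⋃ S : {S : Coalition n // S.1 ⊆ T.1}, F S.1

/-- The point of the standard simplex with the barycentric coordinates of `p`. -/
def bar {n : ℕ} (M : ℝ) (p : Fin n → ℝ) : EuclideanSpace ℝ (Fin n) := WithLp.toLp 2 (-M⁻¹ • p)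

lemma bar_mem {n : ℕ} {M : ℝ} (hM : 0 < M) {p : Fin n → ℝ} (hp : p ∈ boundary n M) :
    bar M p - bary n ≠ 0 ∧ bar M p - bary n ∈ vectorSpan ℝ (range (firm (n := n))) := by
  simp only [boundary, mem_iUnion] at hp
  obtain ⟨⟨T, hT⟩, hp⟩ := hp
  obtain ⟨j, hj⟩ : ∃ j, j ∉ T := by
    by_contra! h
    exact hT (Finset.eq_univ_of_forall h)
  have hn : 0 < n := j.pos
  constructor
  · have h0 : p j = 0 := by
      have : face M T ⊆ {q : Fin n → ℝ | q j = 0} := by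
        refine convexHull_min ?_ ?_
        · rintro _ ⟨i, hi, rfl⟩
          have : j ≠ i := fun h => hj (h ▸ hi)
          simp [this]
        · exact (convex_singleton (0 : ℝ)).linear_preimage (LinearMap.proj j : (Fin n → ℝ) →ₗ[ℝ] ℝ)
      exact this hp
    intro h
    have := congrArg (fun x : EuclideanSpace ℝ (Fin n) => x j) h
    simp [bary, bar, h0] at this
    omega
  · rw [← vsub_eq_sub]
    have hb : bary n ∈ affineSpan ℝ (range (firm (n := n))) :=
      subset_affineSpan _ _ ⟨grand hn, firm_grand hn⟩
    refine vsub_mem_vectorSpan_of_mem_affineSpan_of_mem_affineSpan ?_ hb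
    refine convexHull_subset_affineSpan _ ?_
    let L : (Fin n → ℝ) →ₗ[ℝ] EuclideanSpace ℝ (Fin n) :=
      (-M⁻¹) • (WithLp.linearEquiv 2 ℝ (Fin n → ℝ)).symm.toLinearMap
    have : face M T ⊆ L ⁻¹' convexHull ℝ (range (firm (n := n))) := by
      refine convexHull_min ?_ ((convex_convexHull ℝ _).linear_preimage L)
      rintro _ ⟨i, -, rfl⟩
      refine subset_convexHull _ _ ⟨single i, ?_⟩
      rw [firm_single]
      ext k
      by_cases h : k = i
      · subst h; simp [L, hM.ne']
      · simp [L, h]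
    exact this hp

/-- The identification of the boundary of the scaled simplex with the sphere of directions: the
vertex `-M e_i` corresponds to `e_i = v_{i}`, and the boundary of the standard simplex is projected
radially from its barycenter. -/
def radial (n : ℕ) (M : ℝ) (hM : 0 < M) : C(boundary n M, dirSphere (firm (n := n))) where
  toFun p := ⟨‖bar M p.1 - bary n‖⁻¹ • (bar M p.1 - bary n),
    Submodule.smul_mem _ _ (bar_mem hM p.2).2, by
      have := norm_ne_zero_iff.2 (bar_mem hM p.2).1
      rw [norm_smul, norm_inv, norm_norm, inv_mul_cancel₀ this]⟩
  continuous_toFun := by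
    have h : Continuous fun p : boundary n M => bar M p.1 - bary n := by
      unfold bar; fun_prop
    refine Continuous.subtype_mk ?_ _
    exact (h.norm.inv₀ fun p => norm_ne_zero_iff.2 (bar_mem hM p.2).1).smul h

end ScarfGame

end

/-!
Individual rationality bounds the differences of the coordinates: if `p` lies in the member `F_S` of
the induced cover, then the coordinates `p i` with `i ∈ S` exceed the mean of `p` by at most a
constant. Hence, on the boundary of a large simplex, and in any direction of the hyperplane
`∑ x_i = 0` taken far enough, the players in `S` are not extremal: `S` contains no player at which
the direction `e x` assigned to the point `x` is minimal. The vector `∑ φ_S v_S - r` given by a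
partition of unity is negative at a player that belongs to none of the coalitions involved, and so
is `e x` at its minimal coordinate. Thus the two are nowhere opposite, and every map associated with
the cover is homotopic to the identification `e` of its domain with the sphere of directions.

This map is essential, and `∑ φ_S v_S - r` has a zero in the simplex, i.e. there is a balanced
intersection, because of a theorem of Knaster–Kuratowski–Mazurkiewicz type: a map from the simplex
to `{x | ∑ x_i = 0}` whose `i`-th coordinate is nonpositive on the `i`-th facet has a zero. It is
derived from Scarf's lemma on dominant sets, applied to finer and finer grids. The shift of a
balanced point by `τ` lies in the fractional core.
-/

namespace ScarfGame

/-! ### Scarf's combinatorial lemma -/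

section Scarf

variable {I X Y L : Type*}

lemma card_filter_image_erase_eq_two [DecidableEq I] [DecidableEq Y] {R : Finset Y} {c : Y → I}
    (hcard : (R.image c).card + 1 = R.card) :
    (R.filter fun y => (R.erase y).image c = R.image c).card = 2 := by
  have erase_iff (y : Y) (hy : y ∈ R) :
      (R.erase y).image c = R.image c ↔ ∃ z ∈ R, z ≠ y ∧ c z = c y := by
    constructor
    · intro h
      have hcy : c y ∈ (R.erase y).image c := h ▸ Finset.mem_image_of_mem c hy
      simpa [and_assoc, and_left_comm] using hcy
    · rintro ⟨z, hz, hzy, hcz⟩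
      refine (Finset.image_subset_image (R.erase_subset y)).antisymm fun i hi => ?_
      obtain ⟨x, hx, rfl⟩ := Finset.mem_image.1 hi
      obtain rfl | hxy := eq_or_ne x y
      · exact Finset.mem_image.2 ⟨z, Finset.mem_erase.2 ⟨hzy, hz⟩, hcz⟩
      · exact Finset.mem_image_of_mem c (Finset.mem_erase.2 ⟨hxy, hx⟩)
  obtain ⟨a, ha, b, hb, hab, hcab⟩ := Finset.exists_ne_map_eq_of_card_lt_of_maps_to
    (by omega : (R.image c).card < R.card) fun y hy => Finset.mem_image_of_mem c hy
  have injOn : InjOn c (R.erase a) := by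
    rw [← Finset.card_image_iff, (erase_iff a ha).2 ⟨b, hb, hab.symm, hcab.symm⟩,
      Finset.card_erase_of_mem ha]
    omega
  rw [Finset.card_eq_two]
  refine ⟨a, b, hab, ?_⟩
  ext y
  simp only [Finset.mem_filter, Finset.mem_insert, Finset.mem_singleton]
  constructor
  · rintro ⟨hy, h⟩
    obtain ⟨z, hz, hzy, hczy⟩ := (erase_iff y hy).1 h
    by_contra! hne
    have hya : y ∈ R.erase a := Finset.mem_erase.2 ⟨hne.1, hy⟩
    obtain rfl | hza := eq_or_ne z a
    · exact hne.2 (injOn hya (Finset.mem_erase.2 ⟨hab.symm, hb⟩) (hczy.symm.trans hcab))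
    · exact hzy (injOn (Finset.mem_erase.2 ⟨hza, hz⟩) hya hczy)
  · rintro (rfl | rfl)
    · exact ⟨ha, (erase_iff y ha).2 ⟨b, hb, hab.symm, hcab.symm⟩⟩
    · exact ⟨hb, (erase_iff y hb).2 ⟨a, ha, hab, hcab⟩⟩

lemma even_card_filter_image_erase_eq [Fintype I] [DecidableEq I] [DecidableEq Y] {R : Finset Y}
    {c : Y → I} (i₀ : I) (hcard : R.card = Fintype.card I)
    (hc : R.image c ≠ Finset.univ) :
    Even (R.filter fun y => (R.erase y).image c = Finset.univ.erase i₀).card := by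
  obtain h | ⟨a, ha⟩ :=
    (R.filter fun y => (R.erase y).image c = Finset.univ.erase i₀).eq_empty_or_nonempty
  · simp [h]
  have ha' := (Finset.mem_filter.1 ha).2
  have image_eq : R.image c = Finset.univ.erase i₀ := by
    refine Finset.Subset.antisymm (fun i hi => Finset.mem_erase.2 ⟨?_, Finset.mem_univ i⟩)
      (ha' ▸ Finset.image_subset_image (R.erase_subset a))
    rintro rfl
    refine hc (Finset.eq_univ_of_forall fun j => ?_)
    obtain rfl | hj := eq_or_ne j i
    · exact hi
    · exact Finset.image_subset_image (R.erase_subset a) (ha' ▸ by simp [hj])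
  rw [← image_eq, card_filter_image_erase_eq_two]
  · exact even_two
  · rw [image_eq, Finset.card_erase_of_mem (Finset.mem_univ i₀), Finset.card_univ, hcard]
    exact Nat.sub_add_cancel (Fintype.card_pos_iff.2 ⟨i₀⟩)

variable [LinearOrder L] {u : I → Y → L} {R T : Finset Y} {x : Y} {j : I}

/-- `R` is dominant for the family `u` of utility functions if no alternative is, for all utilities
at once, strictly better than some element of `R`. -/
def IsDominant (u : I → Y → L) (R : Finset Y) : Prop :=
  ∀ x, ∃ i, ∀ y ∈ R, u i x ≤ u i y

/-- The alternatives that are strictly better than a worst element of `T` for every utility but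
possibly the `j`-th one. -/
def beyond (u : I → Y → L) (T : Finset Y) (j : I) : Set Y :=
  {x | ∀ i ≠ j, ∃ y ∈ T, u i y < u i x}

lemma IsDominant.mono (hR : IsDominant u R) (h : T ⊆ R) : IsDominant u T := fun x =>
  (hR x).imp fun _ hi y hy => hi y (h hy)

lemma IsDominant.disjoint_beyond (hT : IsDominant u T) {i j : I} (hij : i ≠ j) :
    Disjoint (beyond u T i) (beyond u T j) := by
  refine Set.disjoint_left.2 fun x hi hj => ?_
  obtain ⟨k, hk⟩ := hT x
  obtain ⟨y, hy, hlt⟩ : ∃ y ∈ T, u k y < u k x := by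
    obtain rfl | hki := eq_or_ne k i
    · exact hj k hij
    · exact hi k hki
  exact (hk y hy).not_gt hlt

lemma IsDominant.insert_iff [DecidableEq Y] (hT : IsDominant u T) (hx : x ∈ beyond u T j) :
    IsDominant u (insert x T) ↔ ∀ x' ∈ beyond u T j, u j x' ≤ u j x := by
  constructor
  · intro hd x' hx'
    obtain ⟨i, hi⟩ := hd x'
    obtain rfl | hij := eq_or_ne i j
    · exact hi x (Finset.mem_insert_self x T)
    · obtain ⟨y, hy, hlt⟩ := hx' i hij
      exact absurd (hi y (Finset.mem_insert_of_mem hy)) hlt.not_ge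
  · intro hmax x'
    by_cases hx' : x' ∈ beyond u T j
    · obtain ⟨i, hi⟩ := hT x'
      obtain rfl | hij := eq_or_ne i j
      · exact ⟨i, Finset.forall_mem_insert _ _ _ |>.2 ⟨hmax x' hx', hi⟩⟩
      · obtain ⟨y, hy, hlt⟩ := hx' i hij
        exact absurd (hi y hy) hlt.not_ge
    · simp only [beyond, mem_ofPred_eq, not_forall, not_exists, not_and, not_lt] at hx'
      obtain ⟨i, hij, hi⟩ := hx'
      obtain ⟨y, hy, hlt⟩ := hx i hij
      exact ⟨i, Finset.forall_mem_insert _ _ _ |>.2 ⟨(hi y hy).trans hlt.le, hi⟩⟩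

section Minimisers

variable [Fintype I] [DecidableEq I] [DecidableEq Y] {m : I → Y}

lemma notMem_of_mem_beyond (hm : ∀ i, ∀ y ∈ T, u i (m i) ≤ u i y)
    (hj : (Finset.univ.erase j).image m = T) (hx : x ∈ beyond u T j) : x ∉ T := by
  intro hxT
  obtain ⟨i, hi, rfl⟩ := Finset.mem_image.1 (hj ▸ hxT)
  obtain ⟨y, hy, hlt⟩ := hx i (Finset.ne_of_mem_erase hi)
  exact (hm i y hy).not_gt hlt

lemma exists_mem_beyond_of_isDominant_insert (hu : ∀ i, Function.Injective (u i))
    (hcard : T.card + 1 = Fintype.card I) (hmT : ∀ i, m i ∈ T)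
    (hm : ∀ i, ∀ y ∈ T, u i (m i) ≤ u i y) (hxT : x ∉ T) (hx : IsDominant u (insert x T)) :
    ∃ j, (Finset.univ.erase j).image m = T ∧ x ∈ beyond u T j := by
  obtain ⟨j, hj⟩ := hx x
  have exists_preimage : ∀ t ∈ T, ∃ i ≠ j, m i = t ∧ u i t < u i x := by
    intro t ht
    have hxt : x ≠ t := fun h => hxT (h ▸ ht)
    obtain ⟨i, hi⟩ := hx t
    have hlt : u i t < u i x := (hi x (Finset.mem_insert_self x T)).lt_of_ne ((hu i).ne hxt.symm)
    refine ⟨i, ?_, hu i ((hm i t ht).antisymm (hi _ (Finset.mem_insert_of_mem (hmT i)))), hlt⟩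
    rintro rfl
    exact (hj t (Finset.mem_insert_of_mem ht)).not_gt hlt
  have image_eq : (Finset.univ.erase j).image m = T := by
    refine (Finset.image_subset_iff.2 fun i _ => hmT i).antisymm fun t ht => ?_
    obtain ⟨i, hij, hi, -⟩ := exists_preimage t ht
    exact Finset.mem_image.2 ⟨i, Finset.mem_erase.2 ⟨hij, Finset.mem_univ i⟩, hi⟩
  have injOn : InjOn m (Finset.univ.erase j : Finset I) := by
    rw [← Finset.card_image_iff, image_eq, Finset.card_erase_of_mem (Finset.mem_univ j),
      Finset.card_univ]
    omega
  refine ⟨j, image_eq, fun i hij => ⟨m i, hmT i, ?_⟩⟩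
  obtain ⟨i', hij', hi', hlt⟩ := exists_preimage (m i) (hmT i)
  rwa [injOn (by simpa using hij') (by simpa using hij) hi'] at hlt

end Minimisers

open Classical in
lemma IsDominant.card_filter_insert_eq_two [Fintype I] [Fintype Y]
    (hu : ∀ i, Function.Injective (u i)) (hT : IsDominant u T)
    (hcard : T.card + 1 = Fintype.card I) (hne : T.Nonempty)
    (hbeyond : ∀ j, (beyond u T j).Nonempty) :
    (Finset.univ.filter fun x => x ∉ T ∧ IsDominant u (insert x T)).card = 2 := by
  choose m hmT hm using fun i => T.exists_min_image (u i) hne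
  choose p hp hpmax using fun j => (beyond u T j).toFinite.exists_maximalFor (u j) _ (hbeyond j)
  replace hpmax (j : I) : ∀ x ∈ beyond u T j, u j x ≤ u j (p j) := fun x hx =>
    (le_total _ _).elim (hpmax j hx) id
  have image_eq : Finset.univ.image m = T := by
    refine (Finset.image_subset_iff.2 fun i _ => hmT i).antisymm fun t ht => ?_
    obtain ⟨i, hi⟩ := hT t
    exact Finset.mem_image.2 ⟨i, Finset.mem_univ i, hu i ((hm i t ht).antisymm (hi _ (hmT i)))⟩
  have card_eq_two : (Finset.univ.filter fun j => (Finset.univ.erase j).image m = T).card = 2 := by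
    have := card_filter_image_erase_eq_two (R := Finset.univ) (c := m)
      (by rw [image_eq, hcard, Finset.card_univ])
    rwa [image_eq] at this
  have p_injective : Function.Injective p := fun i j hij => by
    by_contra hne
    exact Set.disjoint_left.1 (hT.disjoint_beyond hne) (hp i) (hij ▸ hp j)
  rw [← card_eq_two, ← Finset.card_image_of_injective _ p_injective]
  congr 1
  ext x
  simp only [Finset.mem_filter, Finset.mem_univ, true_and, Finset.mem_image]
  constructor
  · rintro ⟨hxT, hx⟩
    obtain ⟨j, hj, hxj⟩ := exists_mem_beyond_of_isDominant_insert hu hcard hmT hm hxT hx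
    exact ⟨j, hj, hu j (((hT.insert_iff hxj).1 hx _ (hp j)).antisymm (hpmax j x hxj))⟩
  · rintro ⟨j, hj, rfl⟩
    exact ⟨notMem_of_mem_beyond hm hj (hp j), (hT.insert_iff (hp j)).2 (hpmax j)⟩
/-- A slack alternative `s i` is worst for the `i`-th utility, while for the other utilities it is
better than every alternative that is not slack. -/
structure IsSlack (u : I → Y → L) (s : I → Y) : Prop where
  le : ∀ i y, u i (s i) ≤ u i y
  lt : ∀ {i j y}, j ≠ i → y ∉ range s → u i y < u i (s j)

namespace IsSlack

variable {s : I → Y}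

lemma beyond_nonempty (hs : IsSlack u s) {y : Y} (hyT : y ∈ T) (hy : y ∉ range s) (j : I) :
    (beyond u T j).Nonempty :=
  ⟨s j, fun _ hij => ⟨y, hyT, hs.lt hij.symm hy⟩⟩

variable [Fintype I] [DecidableEq I] [DecidableEq Y]

lemma isDominant_image_erase (hs : IsSlack u s) (i₀ : I) :
    IsDominant u ((Finset.univ.erase i₀).image s) := by
  intro x
  by_cases hx : x ∈ range s
  · obtain ⟨i, rfl⟩ := hx
    exact ⟨i, fun y _ => hs.le i y⟩
  · refine ⟨i₀, fun y hy => ?_⟩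
    obtain ⟨i, hi, rfl⟩ := Finset.mem_image.1 hy
    exact (hs.lt (Finset.ne_of_mem_erase hi) hx).le

lemma mem_beyond_of_notMem (hs : IsSlack u s) (hu : ∀ i, Function.Injective (u i)) {i₀ : I}
    (hx : x ∉ (Finset.univ.erase i₀).image s) :
    x ∈ beyond u ((Finset.univ.erase i₀).image s) i₀ := by
  intro i hi
  have hsi : s i ∈ (Finset.univ.erase i₀).image s :=
    Finset.mem_image_of_mem s (Finset.mem_erase.2 ⟨hi, Finset.mem_univ i⟩)
  exact ⟨s i, hsi, (hs.le i x).lt_of_ne ((hu i).ne fun h => hx (h ▸ hsi))⟩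

open Classical in
lemma card_filter_insert_eq_one [Fintype Y] (hs : IsSlack u s)
    (hu : ∀ i, Function.Injective (u i)) (hsinj : Function.Injective s) (i₀ : I) :
    (Finset.univ.filter fun x => x ∉ (Finset.univ.erase i₀).image s ∧
      IsDominant u (insert x ((Finset.univ.erase i₀).image s))).card = 1 := by
  set T := (Finset.univ.erase i₀).image s with hT
  have hsT : s i₀ ∉ T := by simp [hT, hsinj.eq_iff]
  obtain ⟨p, hpT, hp⟩ := (Finset.univ.filter (· ∉ T)).exists_max_image (u i₀) ⟨s i₀, by simpa⟩
  simp only [Finset.mem_filter, Finset.mem_univ, true_and] at hpT hp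
  have hd := hs.isDominant_image_erase i₀
  refine Finset.card_eq_one.2 ⟨p, ?_⟩
  ext x
  simp only [Finset.mem_filter, Finset.mem_univ, true_and, Finset.mem_singleton]
  constructor
  · rintro ⟨hxT, hx⟩
    exact hu i₀ ((hp x hxT).antisymm
      ((hd.insert_iff (hs.mem_beyond_of_notMem hu hxT)).1 hx p (hs.mem_beyond_of_notMem hu hpT)))
  · rintro rfl
    exact ⟨hpT, (hd.insert_iff (hs.mem_beyond_of_notMem hu hpT)).2 fun y hy =>
      hp y (notMem_of_mem_beyond (fun i z _ => hs.le i z) hT.symm hy)⟩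

end IsSlack

lemma card_filter_subset_eq_card_filter_insert [Fintype Y] [DecidableEq Y] (P : Finset Y → Prop)
    [DecidablePred P] (T : Finset Y) :
    (Finset.univ.filter fun R => (P R ∧ R.card = T.card + 1) ∧ T ⊆ R).card =
      (Finset.univ.filter fun x => x ∉ T ∧ P (insert x T)).card := by
  refine Eq.trans (congrArg Finset.card ?_)
    (Finset.card_image_of_injOn (f := fun x => insert x T) ?_)
  · ext R
    simp only [Finset.mem_filter, Finset.mem_univ, true_and, Finset.mem_image]
    constructor
    · rintro ⟨⟨hR, hcard⟩, hsub⟩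
      obtain ⟨x, hx, rfl⟩ := Finset.exists_eq_insert_iff.2 ⟨hsub, hcard.symm⟩
      exact ⟨x, ⟨hx, hR⟩, rfl⟩
    · rintro ⟨x, ⟨hx, hR⟩, rfl⟩
      exact ⟨⟨hR, Finset.card_insert_of_notMem hx⟩, Finset.subset_insert x T⟩
  · intro x hx y _ hxy
    have hmem : x ∈ insert y T := by
      rw [← show insert x T = insert y T from hxy]
      exact Finset.mem_insert_self x T
    exact (Finset.mem_insert.1 hmem).resolve_right (Finset.mem_filter.1 hx).2.1

lemma card_filter_subset_eq_card_filter_erase [Fintype Y] [DecidableEq Y] (P : Finset Y → Prop)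
    [DecidablePred P] (R : Finset Y) :
    (Finset.univ.filter fun T => (P T ∧ T.card + 1 = R.card) ∧ T ⊆ R).card =
      (R.filter fun y => P (R.erase y)).card := by
  refine Eq.trans (congrArg Finset.card ?_)
    (Finset.card_image_of_injOn ((Finset.erase_injOn R).mono (Finset.filter_subset _ R)))
  ext T
  simp only [Finset.mem_filter, Finset.mem_univ, true_and, Finset.mem_image]
  constructor
  · rintro ⟨⟨hT, hcard⟩, hsub⟩
    obtain ⟨x, hx, rfl⟩ := Finset.exists_eq_insert_iff.2 ⟨hsub, hcard⟩
    exact ⟨x, ⟨Finset.mem_insert_self x T, by rwa [Finset.erase_insert hx]⟩,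
      Finset.erase_insert hx⟩
  · rintro ⟨y, ⟨hy, hT⟩, rfl⟩
    exact ⟨⟨hT, Finset.card_erase_add_one hy⟩, R.erase_subset y⟩

section Parity

variable [Fintype I] [DecidableEq I] {s : I → Y} {c : Y → I}

lemma eq_image_erase_of_subset_range [DecidableEq Y] (hc : ∀ i, c (s i) = i) {i₀ : I}
    (hT : T.image c = Finset.univ.erase i₀) (hsub : (T : Set Y) ⊆ range s) :
    T = (Finset.univ.erase i₀).image s := by
  rw [← hT, Finset.image_image]
  refine Finset.image_id.symm.trans (Finset.image_congr fun y hy => ?_)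
  obtain ⟨i, rfl⟩ := hsub hy
  simp [hc]

/-- A door, in Scarf's terminology: a dominant set that carries every colour except `i₀`. Of
interest are the doors of size `|I| - 1`, which lead to the rooms, the dominant sets of size `|I|`
containing them. -/
def IsDoor (u : I → Y → L) (c : Y → I) (i₀ : I) (T : Finset Y) : Prop :=
  IsDominant u T ∧ T.image c = Finset.univ.erase i₀

/-- The door made of slack alternatives leads to one room and every other door to two rooms, while a
room without all colours has an even number of doors. -/
theorem IsSlack.exists_isDominant_image_eq_univ [Nonempty I] [Finite Y] (hs : IsSlack u s)
    (hu : ∀ i, Function.Injective (u i)) (hc : ∀ i, c (s i) = i) :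
    ∃ R, IsDominant u R ∧ R.image c = Finset.univ := by
  classical
  have := Fintype.ofFinite Y
  obtain ⟨i₀⟩ := ‹Nonempty I›
  by_contra! hnone
  let doors := Finset.univ.filter fun T => IsDoor u c i₀ T ∧ T.card + 1 = Fintype.card I
  let rooms := Finset.univ.filter fun R => IsDominant u R ∧ R.card = Fintype.card I
  have even_doors (R) (hR : R ∈ rooms) : Even (doors.filter (· ⊆ R)).card := by
    obtain ⟨hR, hcard⟩ := (Finset.mem_filter.1 hR).2
    rw [Finset.filter_filter, ← hcard, card_filter_subset_eq_card_filter_erase (IsDoor u c i₀)]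
    simpa only [IsDoor, hR.mono (R.erase_subset _), true_and] using
      even_card_filter_image_erase_eq i₀ hcard (hnone R hR)
  have card_rooms (T) (hT : T ∈ doors) : (rooms.filter (T ⊆ ·)).card =
      (Finset.univ.filter fun x => x ∉ T ∧ IsDominant u (insert x T)).card := by
    rw [Finset.filter_filter, ← (Finset.mem_filter.1 hT).2.2,
      card_filter_subset_eq_card_filter_insert]
  have hsinj : Function.Injective s := Function.LeftInverse.injective hc
  let T₀ := (Finset.univ.erase i₀).image s
  have hT₀ : T₀ ∈ doors := by
    refine Finset.mem_filter.2 ⟨Finset.mem_univ _, ⟨hs.isDominant_image_erase i₀, ?_⟩, ?_⟩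
    · simp [T₀, Finset.image_image, Function.comp_def, hc]
    · rw [Finset.card_image_of_injective _ hsinj, Finset.card_erase_add_one (Finset.mem_univ i₀),
        Finset.card_univ]
  have odd_slack : Odd (rooms.filter (T₀ ⊆ ·)).card := by
    rw [card_rooms T₀ hT₀, hs.card_filter_insert_eq_one hu hsinj]
    exact odd_one
  have even_other (T) (hT : T ∈ doors.erase T₀) : Even (rooms.filter (T ⊆ ·)).card := by
    obtain ⟨hne, hT⟩ := Finset.mem_erase.1 hT
    obtain ⟨⟨hd, himage⟩, hcard⟩ := (Finset.mem_filter.1 hT).2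
    obtain ⟨y, hyT, hy⟩ := Set.not_subset.1 (mt (eq_image_erase_of_subset_range hc himage) hne)
    rw [card_rooms T hT,
      hd.card_filter_insert_eq_two hu hcard ⟨y, hyT⟩ (hs.beyond_nonempty hyT hy)]
    exact even_two
  refine Nat.not_odd_iff_even.2 (Finset.even_sum _ even_doors) ?_
  have double_count := Finset.sum_card_bipartiteAbove_eq_sum_card_bipartiteBelow
    (s := doors) (t := rooms) (· ⊆ ·)
  simp only [Finset.bipartiteAbove, Finset.bipartiteBelow] at double_count
  rw [← double_count, ← Finset.add_sum_erase _ _ hT₀]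
  exact odd_slack.add_even (Finset.even_sum _ even_other)

end Parity

section SlackUtility

variable [Fintype X] [Fintype I] [DecidableEq I]

/-- The utilities `u` extended to `X ⊕ I` by a slack alternative for every utility, with ties broken
by an enumeration of `X ⊕ I`. -/
noncomputable def slackUtility (u : I → X → L) (i : I) (y : X ⊕ I) :
    WithBot (WithTop L) ×ₗ Fin (Fintype.card (X ⊕ I)) :=
  toLex (y.elim (fun x => ((u i x : WithTop L) : WithBot (WithTop L)))
    fun j => if j = i then ⊥ else ((⊤ : WithTop L) : WithBot (WithTop L)), Fintype.equivFin _ y)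

variable {u : I → X → L}

lemma slackUtility_injective {L : Type*} {u : I → X → L} (i : I) :
    Function.Injective (slackUtility u i) := fun _ _ h =>
  (Fintype.equivFin (X ⊕ I)).injective (congrArg (fun p => (ofLex p).2) h)

lemma le_of_slackUtility_inl_le {i : I} {x y : X}
    (h : slackUtility u i (.inl x) ≤ slackUtility u i (.inl y)) : u i x ≤ u i y := by
  simpa [slackUtility] using ((Prod.Lex.toLex_le_toLex.1 h).elim le_of_lt fun h => h.1.le)

lemma slackUtility_inr_self_lt_inl (i : I) (x : X) :
    slackUtility u i (.inr i) < slackUtility u i (.inl x) :=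
  Prod.Lex.toLex_lt_toLex.2 (Or.inl (by simp))

lemma isSlack_slackUtility : IsSlack (slackUtility u) (Sum.inr : I → X ⊕ I) := by
  constructor
  · rintro i (x | j)
    · exact (slackUtility_inr_self_lt_inl i x).le
    · obtain rfl | hji := eq_or_ne j i
      · exact le_rfl
      · exact (Prod.Lex.toLex_lt_toLex.2 (Or.inl (by simp [hji]))).le
  · rintro i j (x | l) hji hy
    · refine Prod.Lex.toLex_lt_toLex.2 (Or.inl ?_)
      simpa only [Sum.elim_inl, Sum.elim_inr, if_neg hji] using
        WithBot.coe_lt_coe.2 (WithTop.coe_lt_top _)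
    · exact absurd ⟨l, rfl⟩ hy

end SlackUtility

/-- Scarf's lemma: after slack alternatives are adjoined to `X`, the set `C` consists of the
utilities whose slack alternative is not used. -/
theorem exists_dominant_colourful [Finite I] [Finite X] (u : I → X → L) (c : X → I) :
    ∃ (R : Finset X) (C : Finset I),
      (∀ x, ∃ i ∈ C, ∀ y ∈ R, u i x ≤ u i y) ∧ ∀ i ∈ C, ∃ y ∈ R, c y = i := by
  classical
  cases isEmpty_or_nonempty I
  · exact ⟨∅, ∅, fun x => isEmptyElim (c x), by simp⟩
  have := Fintype.ofFinite I
  have := Fintype.ofFinite X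
  obtain ⟨R, hR, himage⟩ := (isSlack_slackUtility (u := u)).exists_isDominant_image_eq_univ
    (c := Sum.elim c id) slackUtility_injective fun _ => rfl
  refine ⟨R.toLeft, Finset.univ.filter fun i => Sum.inr i ∉ R, fun x => ?_, fun i hi => ?_⟩
  · obtain ⟨i, hi⟩ := hR (Sum.inl x)
    exact ⟨i, Finset.mem_filter.2 ⟨Finset.mem_univ i, fun hslack =>
      (slackUtility_inr_self_lt_inl i x).not_ge (hi _ hslack)⟩, fun y hy =>
      le_of_slackUtility_inl_le (hi _ (Finset.mem_toLeft.1 hy))⟩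
  · obtain ⟨y | j, hy, rfl⟩ := Finset.mem_image.1 (himage ▸ Finset.mem_univ i)
    · exact ⟨y, Finset.mem_toLeft.2 hy, rfl⟩
    · exact absurd hy (Finset.mem_filter.1 hi).2

end Scarf

/-! ### The Knaster–Kuratowski–Mazurkiewicz theorem -/

section KKM

variable {I : Type*} [Fintype I]

/-- A dominant set of grid points is small: if it were not, the point exceeding all the minima over
`R` in every coordinate of `C` would be a grid point that contradicts dominance. -/
lemma lt_sum_of_dominant {k : ℕ} {C : Finset I} {R : Set (I → ℕ)} (hC : C.Nonempty)
    (hdom : ∀ x : I → ℕ, ∑ i, x i = k → ∃ i ∈ C, ∀ y ∈ R, x i ≤ y i) {m : I → ℕ}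
    (hm : ∀ i, ∃ y ∈ R, y i = m i) : k < ∑ i ∈ C, (m i + 1) := by
  classical
  by_contra! hle
  obtain ⟨i₁, -⟩ := hC
  let z : I → ℕ := fun i => (if i ∈ C then m i + 1 else 0) +
    if i = i₁ then k - ∑ i ∈ C, (m i + 1) else 0
  have hz : ∑ i, z i = k := by
    simp only [z, Finset.sum_add_distrib (s := Finset.univ), Finset.sum_ite_mem,
      Finset.univ_inter, Finset.sum_ite_eq', Finset.mem_univ, if_true]
    omega
  obtain ⟨i, hiC, hi⟩ := hdom z hz
  obtain ⟨y, hyR, hy⟩ := hm i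
  have := hi y hyR
  simp only [z, hiC, if_true] at this
  omega

lemma le_min_add_card_of_lt_sum {k : ℕ} {C : Finset I} {m y : I → ℕ} (hk : k < ∑ i ∈ C, (m i + 1))
    (hy : ∑ i, y i = k) (hmy : ∀ i, m i ≤ y i) (i : I) :
    (i ∈ C → y i ≤ m i + C.card) ∧ (i ∉ C → y i ≤ C.card) := by
  classical
  rw [Finset.sum_add_distrib, Finset.sum_const, smul_eq_mul, mul_one] at hk
  have split : ∑ i ∈ C, y i + ∑ i ∈ Cᶜ, y i = k := by rw [Finset.sum_add_sum_compl, hy]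
  have excess : ∑ i ∈ C, y i = ∑ i ∈ C, m i + ∑ i ∈ C, (y i - m i) := by
    rw [← Finset.sum_add_distrib]
    exact Finset.sum_congr rfl fun i _ => (Nat.add_sub_cancel' (hmy i)).symm
  constructor <;> intro hi
  · have := Finset.single_le_sum (f := fun i => y i - m i) (fun _ _ => Nat.zero_le _) hi
    omega
  · have := Finset.single_le_sum (f := y) (fun _ _ => Nat.zero_le _) (Finset.mem_compl.2 hi)
    omega

/-- Scarf's lemma for the coordinates as utilities; the point is any element of the dominant set. -/
lemma exists_grid_point [Nonempty I] (k : ℕ) (c : (I → ℕ) → I) :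
    ∃ x : I → ℕ, ∑ i, x i = k ∧ ∀ i, x i ≤ Fintype.card I ∨
      ∃ y : I → ℕ, ∑ i, y i = k ∧ c y = i ∧
        ∀ j, x j ≤ y j + Fintype.card I ∧ y j ≤ x j + Fintype.card I := by
  classical
  have mem_grid (x : I → ℕ) : x ∈ Finset.univ.piAntidiag k ↔ ∑ i, x i = k := by
    simp [Finset.mem_piAntidiag]
  obtain ⟨R, C, hdom, hcol⟩ := exists_dominant_colourful
    (fun i (x : Finset.univ.piAntidiag (ι := I) k) => x.1 i) fun x => c x.1
  obtain ⟨i₀⟩ := ‹Nonempty I›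
  obtain ⟨i₁, hi₁, -⟩ := hdom ⟨Pi.single i₀ k, (mem_grid _).2 (by simp)⟩
  obtain ⟨x, hxR, -⟩ := hcol i₁ hi₁
  choose m hmR hm using fun i => R.exists_min_image (fun y => y.1 i) ⟨x, hxR⟩
  have lt_sum := lt_sum_of_dominant (R := {y | ∃ hy, ⟨y, hy⟩ ∈ R}) ⟨i₁, hi₁⟩
    (fun z hz => (hdom ⟨z, (mem_grid z).2 hz⟩).imp fun i hi => ⟨hi.1, fun y ⟨_, hy⟩ => hi.2 _ hy⟩)
    fun i => ⟨(m i).1, ⟨(m i).2, hmR i⟩, rfl⟩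
  have near (y) (hy : y ∈ R) := le_min_add_card_of_lt_sum lt_sum ((mem_grid y.1).1 y.2)
    fun i => hm i y hy
  have card_le := C.card_le_univ
  refine ⟨x.1, (mem_grid _).1 x.2, fun i => ?_⟩
  by_cases hi : i ∈ C
  · obtain ⟨y, hyR, hy⟩ := hcol i hi
    refine Or.inr ⟨y.1, (mem_grid _).1 y.2, hy, fun j => ?_⟩
    have hmx := hm j x hxR
    have hmy := hm j y hyR
    by_cases hj : j ∈ C
    · have := (near x hxR j).1 hj
      have := (near y hyR j).1 hj
      omega
    · have := (near x hxR j).2 hj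
      have := (near y hyR j).2 hj
      omega
  · exact Or.inl (((near x hxR i).2 hi).trans card_le)

/-- The grid point is the one for `k` with `card I / k ≤ ε`, scaled by `k⁻¹`. -/
lemma exists_point_near_colours [Nonempty I] (c : stdSimplex ℝ I → I) {ε : ℝ} (hε : 0 < ε) :
    ∃ x : stdSimplex ℝ I, ∀ i, x i ≤ ε ∨ ∃ y, c y = i ∧ dist x y ≤ ε := by
  classical
  obtain ⟨k, hk⟩ := exists_nat_gt ((Fintype.card I : ℝ) / ε)
  have hk₀ : (0 : ℝ) < k := (by positivity : (0 : ℝ) ≤ Fintype.card I / ε).trans_lt hk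
  have div_le {a : ℕ} (ha : a ≤ Fintype.card I) : (a : ℝ) / k ≤ ε := by
    rw [div_lt_iff₀ hε] at hk
    rw [div_le_iff₀ hk₀]
    have : (a : ℝ) ≤ Fintype.card I := Nat.cast_le.2 ha
    linarith
  have scaled_mem (x : I → ℕ) (hx : ∑ i, x i = k) : (fun i => (x i : ℝ) / k) ∈ stdSimplex ℝ I :=
    ⟨fun i => by positivity, by rw [← Finset.sum_div, ← Nat.cast_sum, hx, div_self hk₀.ne']⟩
  obtain ⟨i₀⟩ := ‹Nonempty I›
  let scaled (x : I → ℕ) : stdSimplex ℝ I :=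
    if hx : ∑ i, x i = k then ⟨_, scaled_mem x hx⟩ else ⟨_, single_mem_stdSimplex ℝ i₀⟩
  have scaled_apply {x : I → ℕ} (hx : ∑ i, x i = k) (i : I) : scaled x i = (x i : ℝ) / k := by
    simp only [scaled, dif_pos hx]
    rfl
  have : Nonempty I := ⟨i₀⟩
  obtain ⟨x, hx, h⟩ := exists_grid_point k fun x => c (scaled x)
  refine ⟨scaled x, fun i => (h i).imp (fun hi => ?_) fun ⟨y, hy, hcy, hxy⟩ => ⟨_, hcy, ?_⟩⟩
  · rw [scaled_apply hx]
    exact div_le hi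
  · refine (dist_pi_le_iff hε.le).2 fun j => ?_
    change |scaled x j - scaled y j| ≤ ε
    have hd := div_le le_rfl
    have h₁ : (x j : ℝ) ≤ y j + Fintype.card I := mod_cast (hxy j).1
    have h₂ : (y j : ℝ) ≤ x j + Fintype.card I := mod_cast (hxy j).2
    rw [scaled_apply hx, scaled_apply hy, ← sub_div, abs_div, abs_of_pos hk₀]
    refine (div_le_div_of_nonneg_right ?_ hk₀.le).trans hd
    exact abs_sub_le_iff.2 ⟨by linarith, by linarith⟩

/-- The sets `C i` contain the facets opposite to the vertices, and not, as in the usual formulation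
of the Knaster–Kuratowski–Mazurkiewicz theorem, the vertices. -/
theorem iInter_nonempty_of_isClosed_of_facet_subset [Nonempty I] {C : I → Set (stdSimplex ℝ I)}
    (hclosed : ∀ i, IsClosed (C i)) (hcover : ⋃ i, C i = univ)
    (hfacet : ∀ i (b : stdSimplex ℝ I), b i = 0 → b ∈ C i) : (⋂ i, C i).Nonempty := by
  choose c hc using fun b => mem_iUnion.1 (hcover ▸ mem_univ b)
  choose x hx using fun k : ℕ => exists_point_near_colours c (Nat.one_div_pos_of_nat (n := k))
  obtain ⟨b, -, φ, hφ, hxb⟩ := isCompact_univ.tendsto_subseq fun k => mem_univ (x k)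
  have hε : Filter.Tendsto (fun k => 1 / ((φ k : ℝ) + 1)) Filter.atTop (nhds 0) :=
    tendsto_one_div_add_atTop_nhds_zero_nat.comp hφ.tendsto_atTop
  refine ⟨b, mem_iInter.2 fun i => ?_⟩
  obtain hbi | hbi := eq_or_ne (b i) 0
  · exact hfacet i b hbi
  have hxbi : Filter.Tendsto (fun k => x (φ k) i) Filter.atTop (nhds (b i)) :=
    (((continuous_apply i).comp continuous_subtype_val).tendsto b).comp hxb
  have hlarge : ∀ᶠ k in Filter.atTop, 1 / ((φ k : ℝ) + 1) < x (φ k) i :=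
    hε.eventually_lt hxbi (hbi.symm.lt_of_le (b.2.1 i))
  rw [← (hclosed i).closure_eq, Metric.mem_closure_iff]
  intro δ hδ
  obtain ⟨k, hk, hεk, hxk⟩ := (hlarge.and ((hε.eventually_lt_const (half_pos hδ)).and
    (hxb.eventually (ball_mem_nhds b (half_pos hδ))))).exists
  obtain ⟨y, rfl, hy⟩ := (hx (φ k) i).resolve_left hk.not_ge
  refine ⟨y, hc y, ?_⟩
  have := dist_triangle_left b y (x (φ k))
  have := mem_ball.1 hxk
  simp only [Function.comp_apply] at this
  linarith

theorem exists_eq_zero_of_facet_nonpos [Nonempty I] (h : C(stdSimplex ℝ I, I → ℝ))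
    (hsum : ∀ b, ∑ i, h b i = 0) (hfacet : ∀ b i, b i = 0 → h b i ≤ 0) : ∃ b, h b = 0 := by
  obtain ⟨b, hb⟩ := iInter_nonempty_of_isClosed_of_facet_subset (C := fun i => {b | h b i ≤ 0})
    (fun i => isClosed_le (by fun_prop) continuous_const)
    (eq_univ_of_forall fun b => mem_iUnion.2 <| by
      obtain ⟨i, -, hi⟩ := Finset.exists_le_of_sum_le Finset.univ_nonempty
        ((hsum b).trans Finset.sum_const_zero.symm).le
      exact ⟨i, hi⟩)
    fun i b => hfacet b i
  exact ⟨b, funext fun i => (Finset.sum_eq_zero_iff_of_nonpos fun i _ => mem_iInter.1 hb i).1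
    (hsum b) i (Finset.mem_univ i)⟩

end KKM

/-! ### Covers, partitions of unity and homotopies -/

section Topology

variable {ι X Z : Type*} [TopologicalSpace X] [TopologicalSpace Z]

lemma exists_isOpen_superset_iInter_eq_empty [NormalSpace X] {F : ι → Set X}
    (hF : ∀ i, IsClosed (F i)) {S : Finset ι} (hS : ⋂ i ∈ S, F i = ∅) :
    ∃ W : ι → Set X, (∀ i, IsOpen (W i)) ∧ (∀ i, F i ⊆ W i) ∧ ⋂ i ∈ S, W i = ∅ := by
  obtain ⟨v, hv, hclosed, hsub⟩ := exists_iUnion_eq_closed_subset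
    (u := fun i => {x | i ∈ S ∧ x ∉ F i})
    (fun i => (isOpen_const (p := i ∈ S)).inter (hF i).isOpen_compl)
    (fun x => S.finite_toSet.subset fun i hi => hi.1) (eq_univ_of_forall fun x => by
      simpa [← hS] using eq_empty_iff_forall_notMem.1 hS x)
  refine ⟨fun i => (v i)ᶜ, fun i => (hclosed i).isOpen_compl,
    fun i x hx hxv => (hsub i hxv).2 hx, eq_empty_of_forall_notMem fun x hx => ?_⟩
  obtain ⟨i, hi⟩ := mem_iUnion.1 (hv ▸ mem_univ x)
  exact mem_iInter₂.1 hx i (hsub i hi).1 hi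

lemma exists_isOpen_superset_iInter_nonempty_iff [Finite ι] [NormalSpace X] {F : ι → Set X}
    (hF : ∀ i, IsClosed (F i)) :
    ∃ W : ι → Set X, (∀ i, IsOpen (W i)) ∧ (∀ i, F i ⊆ W i) ∧
      ∀ S : Finset ι, (⋂ i ∈ S, F i).Nonempty ↔ (⋂ i ∈ S, W i).Nonempty := by
  have exists_swelling (S : Finset ι) : ∃ W : ι → Set X, (∀ i, IsOpen (W i)) ∧
      (∀ i, F i ⊆ W i) ∧ ((⋂ i ∈ S, W i).Nonempty → (⋂ i ∈ S, F i).Nonempty) := by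
    obtain hS | hS := (⋂ i ∈ S, F i).eq_empty_or_nonempty
    · obtain ⟨W, hW, hFW, hWS⟩ := exists_isOpen_superset_iInter_eq_empty hF hS
      exact ⟨W, hW, hFW, fun h => (h.ne_empty hWS).elim⟩
    · exact ⟨fun _ => univ, fun _ => isOpen_univ, fun _ => subset_univ _, fun _ => hS⟩
  choose W hW hFW hWF using exists_swelling
  refine ⟨fun i => ⋂ S, W S i, fun i => isOpen_iInter_of_finite fun S => hW S i,
    fun i => subset_iInter fun S => hFW S i, fun S => ⟨fun h => h.mono ?_, fun h => hWF S ?_⟩⟩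
  · exact iInter₂_mono fun i _ => subset_iInter fun T => hFW T i
  · exact h.mono (iInter₂_mono fun i _ => iInter_subset _ S)

lemma exists_partitionOfUnity_isSubordinate [Finite ι] [NormalSpace X] {W : ι → Set X}
    (hW : ∀ i, IsOpen (W i)) (hcover : ⋃ i, W i = univ) :
    ∃ φ : PartitionOfUnity ι X, φ.IsSubordinate W :=
  (BumpCovering.exists_isSubordinate_of_locallyFinite isClosed_univ W hW
    (locallyFinite_of_finite W) hcover.ge).imp' BumpCovering.toPartitionOfUnity
    fun _ h => h.toPartitionOfUnity

lemma sum_partitionOfUnity_eq_one [Fintype ι] (φ : PartitionOfUnity ι X) (x : X) :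
    ∑ i, φ i x = 1 := by
  rw [← finsum_eq_sum_of_fintype]
  exact φ.sum_eq_one (mem_univ x)

lemma mem_of_isSubordinate_of_ne_zero {φ : PartitionOfUnity ι X} {W : ι → Set X}
    (hφ : φ.IsSubordinate W) {i : ι} {x : X} (hi : φ i x ≠ 0) : x ∈ W i :=
  hφ i (subset_tsupport _ hi)

variable {E : Type*} [NormedAddCommGroup E] [NormedSpace ℝ E]

/-- The null-homotopy `H` is run along the radii: `x` goes to `H(2 - 2‖x‖, x / ‖x‖)`, which is
constant near the origin. -/
theorem exists_extension_of_nullhomotopic {f : C(sphere (0 : E) 1, Z)} (hf : f.Nullhomotopic) :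
    ∃ K : C(E, Z), ∀ (x : sphere (0 : E) 1) (t : ℝ), 1 ≤ t → K (t • (x : E)) = f x := by
  classical
  obtain ⟨q, ⟨H⟩⟩ := hf
  have unit {x : E} (hx : x ≠ 0) : ‖x‖⁻¹ • x ∈ sphere (0 : E) 1 := by
    rw [mem_sphere_zero_iff_norm, norm_smul, norm_inv, norm_norm,
      inv_mul_cancel₀ (norm_ne_zero_iff.2 hx)]
  let K (x : E) : Z :=
    if hx : x = 0 then q else H (projIcc 0 1 zero_le_one (2 - 2 * ‖x‖), ⟨_, unit hx⟩)
  have K_near_zero : ∀ x ∈ ball (0 : E) (1 / 2), K x = q := by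
    intro x hx
    by_cases h0 : x = 0
    · exact dif_pos h0
    · have : ‖x‖ < 1 / 2 := mem_ball_zero_iff.1 hx
      simp only [K, h0, dif_neg, not_false_eq_true]
      rw [projIcc_of_right_le _ (by linarith)]
      exact H.apply_one _
  have continuous_K : Continuous K := by
    rw [continuous_iff_continuousAt]
    intro x
    obtain rfl | h0 := eq_or_ne x 0
    · exact continuousAt_const.congr (Filter.eventuallyEq_of_mem
        (ball_mem_nhds 0 (by norm_num)) fun y hy => (K_near_zero y hy).symm)
    · refine ContinuousOn.continuousAt (s := {x | x ≠ 0}) ?_ (isOpen_ne.mem_nhds h0)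
      rw [continuousOn_iff_continuous_domRestrict]
      have hK : domRestrict {x : E | x ≠ 0} K = fun x : {x : E | x ≠ 0} =>
          H (projIcc 0 1 zero_le_one (2 - 2 * ‖x.1‖), ⟨_, unit x.2⟩) :=
        funext fun x => dif_neg x.2
      rw [hK]
      refine H.continuous.comp ((continuous_projIcc.comp (by fun_prop)).prodMk ?_)
      exact ((continuous_subtype_val.norm.inv₀ fun x => norm_ne_zero_iff.2 x.2).smul
        continuous_subtype_val).subtype_mk _
  refine ⟨⟨K, continuous_K⟩, fun x t ht => ?_⟩
  have hx : ‖(x : E)‖ = 1 := mem_sphere_zero_iff_norm.1 x.2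
  have ht₀ : 0 < t := one_pos.trans_le ht
  have hnorm : ‖t • (x : E)‖ = t := by rw [norm_smul, hx, mul_one, Real.norm_of_nonneg ht₀.le]
  have h0 : t • (x : E) ≠ 0 := norm_pos_iff.1 (hnorm.symm ▸ ht₀)
  simp only [ContinuousMap.coe_mk, K, h0, dif_neg, not_false_eq_true]
  rw [projIcc_of_le_left _ (by linarith)]
  refine (H.apply_zero _).trans (congrArg f (Subtype.ext ?_))
  simp only [hnorm, inv_smul_smul₀ ht₀.ne']

end Topology

section DirSphere

variable {ι X : Type} [TopologicalSpace X] {d : ℕ} {v : ι → EuclideanSpace ℝ (Fin d)}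

/-- The map to the sphere of directions obtained by normalizing a map without zeros to the direction
space of the affine span of `v`. -/
noncomputable def toDirSphere (f : C(X, EuclideanSpace ℝ (Fin d)))
    (hspan : ∀ x, f x ∈ vectorSpan ℝ (range v)) (hf : ∀ x, f x ≠ 0) : C(X, dirSphere v) where
  toFun x := ⟨‖f x‖⁻¹ • f x, Submodule.smul_mem _ _ (hspan x), by
    rw [norm_smul, norm_inv, norm_norm, inv_mul_cancel₀ (norm_ne_zero_iff.2 (hf x))]⟩
  continuous_toFun := ((f.continuous.norm.inv₀ fun x => norm_ne_zero_iff.2 (hf x)).smul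
    f.continuous).subtype_mk _

/-- Normalize the segments joining `f x` to `g x`. -/
lemma homotopic_of_forall_ne_neg {f g : C(X, dirSphere v)}
    (h : ∀ x, (f x : EuclideanSpace ℝ (Fin d)) ≠ -g x) : f.Homotopic g := by
  let L : C(unitInterval × X, EuclideanSpace ℝ (Fin d)) :=
    ⟨fun p => (1 - (p.1 : ℝ)) • (f p.2).1 + (p.1 : ℝ) • (g p.2).1, by fun_prop⟩
  have L_ne_zero (p) : L p ≠ 0 := by
    intro h0
    have hneg : (1 - (p.1 : ℝ)) • (f p.2).1 = (p.1 : ℝ) • -(g p.2).1 := by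
      rw [smul_neg]
      exact eq_neg_of_add_eq_zero_left h0
    have hnorm := congrArg norm hneg
    rw [norm_smul, norm_smul, norm_neg, (f p.2).2.2, (g p.2).2.2, mul_one, mul_one,
      Real.norm_of_nonneg (sub_nonneg.2 p.1.2.2), Real.norm_of_nonneg p.1.2.1] at hnorm
    rw [hnorm] at hneg
    exact h p.2 (smul_right_injective _ (by linarith : (p.1 : ℝ) ≠ 0) hneg)
  refine ⟨⟨toDirSphere L (fun p => Submodule.add_mem _ (Submodule.smul_mem _ _ (f p.2).2.1)
    (Submodule.smul_mem _ _ (g p.2).2.1)) L_ne_zero, fun x => Subtype.ext ?_,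
    fun x => Subtype.ext ?_⟩⟩
  · simp [toDirSphere, L, (f x).2.2]
  · simp [toDirSphere, L, (g x).2.2]

lemma homotopic_of_forall_exists_neg {f g : C(X, dirSphere v)}
    (h : ∀ x, ∃ j, (f x).1 j < 0 ∧ (g x).1 j < 0) : f.Homotopic g :=
  homotopic_of_forall_ne_neg fun x hx => by
    obtain ⟨j, hf, hg⟩ := h x
    rw [hx, PiLp.neg_apply, neg_lt_zero] at hf
    exact hf.not_gt hg

/-- The map between unit spheres induced by a linear isometry `A`, which plays the role of an
identification of a standard sphere with the sphere of directions. -/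
noncomputable def dirMap {E : Type} [NormedAddCommGroup E] [NormedSpace ℝ E]
    (A : E ≃ₗᵢ[ℝ] vectorSpan ℝ (range v)) : C(sphere (0 : E) 1, dirSphere v) where
  toFun y := ⟨A y.1, (A y.1).2, by
    rw [Submodule.norm_coe, A.norm_map, mem_sphere_zero_iff_norm.1 y.2]⟩
  continuous_toFun := by fun_prop

end DirSphere

lemma homologyMap_eq_of_homotopic {X Y : Type} [TopologicalSpace X] [TopologicalSpace Y] (m : ℕ)
    {f g : C(X, Y)} (h : f.Homotopic g) : homologyMap m f = homologyMap m g := by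
  obtain ⟨H⟩ := h
  have H' : TopCat.Homotopy (TopCat.ofHom f) (TopCat.ofHom g) := H
  exact congrArg ModuleCat.Hom.hom
    (H'.congr_homologyMap_singularChainComplexFunctor (ModuleCat.of ℤ ℤ) m)

lemma hasDegree_one_of_homotopic {X Y : Type} [TopologicalSpace X] [TopologicalSpace Y] (m : ℕ)
    {e f : C(X, Y)} (h : e.Homotopic f) : HasDegree e f m 1 := fun z _ => by
  rw [one_smul, homologyMap_eq_of_homotopic m h]

/-! ### Balanced sets and maps associated with covers -/

section Balance

variable {ι : Type} {d : ℕ} {v : ι → EuclideanSpace ℝ (Fin d)}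
  {r : EuclideanSpace ℝ (Fin d)} {S : Finset ι}

lemma IsWeights.isConvRBalanced {lam : ι → ℝ} (h : IsWeights v r S lam)
    (hone : ∑ i ∈ S, lam i = 1) : IsConvRBalanced v r S := by
  rw [IsConvRBalanced, ← h.2]
  exact (convex_convexHull ℝ _).sum_mem h.1 hone fun i hi => subset_convexHull _ _ ⟨i, hi, rfl⟩

lemma IsConvRBalanced.isRBalanced (h : IsConvRBalanced v r S) : IsRBalanced v r S := by
  classical
  have hconv : Convex ℝ {x | IsRBalanced v x S} := by
    rintro x ⟨lx, hx₀, hx⟩ y ⟨ly, hy₀, hy⟩ a b ha hb -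
    refine ⟨fun i => a * lx i + b * ly i, fun i hi =>
      add_nonneg (mul_nonneg ha (hx₀ i hi)) (mul_nonneg hb (hy₀ i hi)), ?_⟩
    simp only [add_smul, mul_smul, Finset.sum_add_distrib, ← Finset.smul_sum, hx, hy]
  refine convexHull_min ?_ hconv h
  rintro _ ⟨i, hi, rfl⟩
  refine ⟨fun j => if j = i then 1 else 0, fun j _ => by positivity, ?_⟩
  simp [ite_smul, Finset.mem_coe.1 hi]

lemma isConvexPair_of_forall_eq_one (l : EuclideanSpace ℝ (Fin d) →ₗ[ℝ] ℝ)
    (hv : ∀ i, l (v i) = 1) (hr : l r = 1) : IsConvexPair v r := fun S =>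
  ⟨fun ⟨lam, hlam⟩ => hlam.isConvRBalanced <| by
    simpa [hv, hr] using congrArg l hlam.2, IsConvRBalanced.isRBalanced⟩

variable [Fintype ι] {X : Type} [TopologicalSpace X] {φ : PartitionOfUnity ι X}
  {F W : ι → Set X} {x : X}

/-- The map `x ↦ ∑ i, φ i x • v i - r`, whose normalization is the map associated with a cover. -/
noncomputable def offset (φ : PartitionOfUnity ι X) (v : ι → EuclideanSpace ℝ (Fin d))
    (r : EuclideanSpace ℝ (Fin d)) : C(X, EuclideanSpace ℝ (Fin d)) where
  toFun x := ∑ i, φ i x • v i - r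
  continuous_toFun := by fun_prop

lemma offset_mem_vectorSpan (φ : PartitionOfUnity ι X) (hr : r ∈ affineSpan ℝ (range v)) (x : X) :
    offset φ v r x ∈ vectorSpan ℝ (range v) :=
  vsub_mem_vectorSpan_of_mem_affineSpan_of_mem_affineSpan (convexHull_subset_affineSpan _
    ((convex_convexHull ℝ _).sum_mem (fun i _ => φ.nonneg i x) (sum_partitionOfUnity_eq_one φ x)
      fun i _ => subset_convexHull _ _ ⟨i, rfl⟩)) hr

lemma hasBalancedIntersection_of_offset_eq_zero (hφ : φ.IsSubordinate W)
    (hnerve : ∀ S : Finset ι, (⋂ i ∈ S, F i).Nonempty ↔ (⋂ i ∈ S, W i).Nonempty)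
    (h : offset φ v r x = 0) : HasBalancedIntersection F v r := by
  classical
  let S : Finset ι := {i | φ i x ≠ 0}
  have hsum : ∑ i ∈ S, φ i x = 1 :=
    (Finset.sum_filter_ne_zero _).trans (sum_partitionOfUnity_eq_one φ x)
  have hr : ∑ i ∈ S, φ i x • v i = r := by
    rw [← sub_eq_zero.1 h]
    exact Finset.sum_filter_of_ne fun i _ hi h₀ => hi (by rw [h₀, zero_smul])
  exact ⟨S, IsWeights.isConvRBalanced ⟨fun i _ => φ.nonneg i x, hr⟩ hsum, (hnerve S).2 ⟨x,
    mem_iInter₂.2 fun i hi => mem_of_isSubordinate_of_ne_zero hφ (Finset.mem_filter.1 hi).2⟩⟩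

theorem exists_isCoverMap_of_not_hasBalancedIntersection [NormalSpace X]
    (hr : r ∈ affineSpan ℝ (range v)) (hF : ∀ i, IsClosed (F i)) (hcover : ⋃ i, F i = univ)
    (h : ¬ HasBalancedIntersection F v r) : ∃ g, IsCoverMap F v r g := by
  obtain ⟨W, hW, hFW, hnerve⟩ := exists_isOpen_superset_iInter_nonempty_iff hF
  obtain ⟨φ, hφ⟩ := exists_partitionOfUnity_isSubordinate hW
    (univ_subset_iff.1 (hcover.ge.trans (iUnion_mono hFW)))
  exact ⟨toDirSphere (offset φ v r) (offset_mem_vectorSpan φ hr) fun x h₀ =>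
    h (hasBalancedIntersection_of_offset_eq_zero hφ hnerve h₀), W, φ, hW, hFW, hnerve, hφ,
    fun _ => rfl⟩

end Balance

section Firms

variable {n : ℕ}

/-- The sum of the coordinates, which is the affine function on `ℝⁿ` that equals `1` at all
firms. -/
noncomputable def coordSum (n : ℕ) : EuclideanSpace ℝ (Fin n) →ₗ[ℝ] ℝ :=
  ∑ i, (EuclideanSpace.proj i : EuclideanSpace ℝ (Fin n) →L[ℝ] ℝ).toLinearMap

lemma coordSum_apply (u : EuclideanSpace ℝ (Fin n)) : coordSum n u = ∑ i, u i := by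
  simp [coordSum]

lemma coordSum_firm (S : Coalition n) : coordSum n (firm S) = 1 := by
  have : (S.1.card : ℝ) ≠ 0 := Nat.cast_ne_zero.2 S.2.card_ne_zero
  simp [coordSum_apply, firm, this]

lemma bary_mem_affineSpan (n : ℕ) [NeZero n] :
    bary n ∈ affineSpan ℝ (range (firm (n := n))) :=
  subset_affineSpan _ _ ⟨grand (NeZero.pos n), firm_grand _⟩

lemma isConvexPair_firm_bary (n : ℕ) [NeZero n] : IsConvexPair (firm (n := n)) (bary n) :=
  isConvexPair_of_forall_eq_one (coordSum n) coordSum_firm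
    (firm_grand (NeZero.pos n) ▸ coordSum_firm _)

lemma mem_vectorSpan_firm_iff {u : EuclideanSpace ℝ (Fin n)} :
    u ∈ vectorSpan ℝ (range (firm (n := n))) ↔ ∑ i, u i = 0 := by
  refine ⟨fun hu => ?_, fun hu => ?_⟩
  · have : vectorSpan ℝ (range (firm (n := n))) ≤ LinearMap.ker (coordSum n) := by
      refine Submodule.span_le.2 ?_
      rintro _ ⟨_, ⟨S, rfl⟩, _, ⟨T, rfl⟩, rfl⟩
      simp [coordSum_firm]
    rw [← coordSum_apply]
    exact this hu
  · have hsum : u = ∑ i, u i • (firm (single i) -ᵥ bary n) := by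
      ext j
      simp [firm_single, smul_sub, ← Finset.sum_smul, hu, Pi.single_apply]
    rw [hsum]
    exact Submodule.sum_mem _ fun i _ => Submodule.smul_mem _ _ <|
      vsub_mem_vectorSpan ℝ ⟨single i, rfl⟩ ⟨grand i.pos, firm_grand i.pos⟩

/-- If `u i` is minimal, then `1 = ∑ j, u j ^ 2 = ∑ j, u j * (u j - u i) ≤ ∑ j, (u j - u i)` because
of `u j ≤ 1`, and the last sum is `-n * u i`. -/
lemma nat_mul_apply_le_neg_one (u : dirSphere (firm (n := n))) {i : Fin n}
    (hi : ∀ j, u.1 i ≤ u.1 j) : n * u.1 i ≤ -1 := by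
  have hsum : ∑ j, u.1 j = 0 := mem_vectorSpan_firm_iff.1 u.2.1
  have hsq : ∑ j, u.1 j ^ 2 = 1 := by
    rw [← EuclideanSpace.real_norm_sq_eq, u.2.2, one_pow]
  have le_one (j : Fin n) : u.1 j ≤ 1 :=
    (le_abs_self _).trans ((PiLp.norm_apply_le u.1 j).trans_eq u.2.2)
  have : ∑ j, u.1 j ^ 2 ≤ ∑ j, (u.1 j * u.1 i + (u.1 j - u.1 i)) := by
    refine Finset.sum_le_sum fun j _ => ?_
    nlinarith [mul_nonneg (sub_nonneg.2 (le_one j)) (sub_nonneg.2 (hi j))]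
  rw [Finset.sum_add_distrib, ← Finset.sum_mul, Finset.sum_sub_distrib, hsum, hsq] at this
  simp at this
  linarith

lemma exists_forall_apply_le (u : dirSphere (firm (n := n))) : ∃ i, ∀ j, u.1 i ≤ u.1 j := by
  have : Nonempty (Fin n) := by
    by_contra h
    rw [not_nonempty_iff] at h
    have := u.2.2
    simp [Subsingleton.elim u.1 0] at this
  exact Finite.exists_min _

lemma apply_neg_of_forall_le (u : dirSphere (firm (n := n))) {i : Fin n}
    (hi : ∀ j, u.1 i ≤ u.1 j) : u.1 i < 0 := by
  by_contra! h
  have := nat_mul_apply_le_neg_one u hi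
  have : 0 ≤ n * u.1 i := by positivity
  linarith

lemma not_isConvRBalanced_of_forall_notMem {Φ : Finset (Coalition n)} {j : Fin n}
    (h : ∀ S ∈ Φ, j ∉ S.1) : ¬ IsConvRBalanced firm (bary n) Φ := by
  intro hb
  obtain ⟨lam, -, hlam⟩ := hb.isRBalanced
  have hj : bary n j = 0 := by
    rw [← hlam, WithLp.ofLp_sum, Finset.sum_apply]
    exact Finset.sum_eq_zero fun S hS => by simp [firm, h S hS]
  simp only [bary, inv_eq_zero, Nat.cast_eq_zero] at hj
  exact j.pos.ne' hj

variable {X : Type} [TopologicalSpace X]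

lemma offset_firm_apply_neg {φ : PartitionOfUnity (Coalition n) X} {x : X} {j : Fin n}
    (h : ∀ S, φ S x ≠ 0 → j ∉ S.1) : offset φ firm (bary n) x j < 0 := by
  have hsum : (∑ S, φ S x • firm S) j = 0 := by
    rw [WithLp.ofLp_sum, Finset.sum_apply]
    refine Finset.sum_eq_zero fun S _ => ?_
    by_cases hS : φ S x = 0
    · simp [hS]
    · simp [firm, h S hS]
  change (∑ S, φ S x • firm S) j - (n : ℝ)⁻¹ < 0
  rw [hsum, zero_sub, neg_lt_zero]
  exact inv_pos.2 (Nat.cast_pos.2 j.pos)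

/-- The zeros of `offset` are balanced intersections, and a partition of unity with `φ S b = 0`
as soon as a player of `S` has weight `0` in `b` gives a map that satisfies the boundary condition
of `exists_eq_zero_of_facet_nonpos`. -/
theorem hasBalancedIntersection_of_stdSimplex [NeZero n]
    {F : Coalition n → Set (stdSimplex ℝ (Fin n))} (hF : ∀ S, IsClosed (F S))
    (hcover : ⋃ S, F S = univ) (hne : ∀ S, ∀ b ∈ F S, ∀ i ∈ S.1, b i ≠ 0) :
    HasBalancedIntersection F firm (bary n) := by
  obtain ⟨W, hW, hFW, hnerve⟩ := exists_isOpen_superset_iInter_nonempty_iff hF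
  have isOpen_ne_zero (S : Coalition n) :
      IsOpen {b : stdSimplex ℝ (Fin n) | ∀ i ∈ S.1, b i ≠ 0} := by
    simp only [Set.ofPred_forall]
    exact isOpen_biInter_finset fun i _ => isOpen_ne_fun
      ((continuous_apply i).comp continuous_subtype_val) continuous_const
  obtain ⟨φ, hφ⟩ := exists_partitionOfUnity_isSubordinate
    (fun S => (hW S).inter (isOpen_ne_zero S))
    (univ_subset_iff.1 (hcover.ge.trans (iUnion_mono fun S b hb => ⟨hFW S hb, hne S b hb⟩)))
  let h : C(stdSimplex ℝ (Fin n), Fin n → ℝ) :=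
    ⟨fun b => (offset φ firm (bary n) b).ofLp, by fun_prop⟩
  obtain ⟨b, hb⟩ := exists_eq_zero_of_facet_nonpos h
    (fun b => mem_vectorSpan_firm_iff.1
      (offset_mem_vectorSpan φ (bary_mem_affineSpan n) b))
    fun b i hi => (offset_firm_apply_neg fun S hS hiS =>
        (mem_of_isSubordinate_of_ne_zero hφ hS).2 i hiS hi).le
  exact hasBalancedIntersection_of_offset_eq_zero (fun S => (hφ S).trans inter_subset_left) hnerve
    (WithLp.ofLp_injective 2 hb)

end Firms

section DirMap

variable {n : ℕ} [NeZero n] {E : Type} [NormedAddCommGroup E] [NormedSpace ℝ E]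

/-- An extension `K` of the map to the whole space would give the map `b ↦ K (n • (b - bary n))` on
the simplex. The `i`-th coordinate of `n • (b - bary n)` is `-1` on the facet opposite to the
`i`-th vertex, so that this vector has norm at least `1` there and `K` only rescales it. -/
theorem not_nullhomotopic_dirMap (A : E ≃ₗᵢ[ℝ] vectorSpan ℝ (range (firm (n := n)))) :
    ¬ (dirMap A).Nullhomotopic := by
  intro hnull
  obtain ⟨K, hK⟩ := exists_extension_of_nullhomotopic hnull
  have hn : (n : ℝ) ≠ 0 := NeZero.ne _
  let w (b : stdSimplex ℝ (Fin n)) : vectorSpan ℝ (range (firm (n := n))) :=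
    ⟨(n : ℝ) • (WithLp.toLp 2 b.1 - bary n), mem_vectorSpan_firm_iff.2 <| by
      simp [bary, ← Finset.mul_sum, b.2.2, hn]⟩
  have hw : Continuous w := by fun_prop
  obtain ⟨b, hb⟩ := exists_eq_zero_of_facet_nonpos
    ⟨fun b => (K (A.symm (w b))).1.ofLp, by fun_prop⟩
    (fun b => mem_vectorSpan_firm_iff.1 (K (A.symm (w b))).2.1) fun b i hi => by
      have hwi : (w b).1 i = -1 := by
        change (n : ℝ) * (b i - (n : ℝ)⁻¹) = -1
        rw [hi, zero_sub, mul_neg, mul_inv_cancel₀ hn]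
      have one_le : 1 ≤ ‖A.symm (w b)‖ := by
        have := PiLp.norm_apply_le (w b).1 i
        rwa [hwi, norm_neg, norm_one, Submodule.norm_coe, ← A.symm.norm_map] at this
      have hpos := one_pos.trans_le one_le
      have hunit : ‖A.symm (w b)‖⁻¹ • A.symm (w b) ∈ sphere (0 : E) 1 := by
        rw [mem_sphere_zero_iff_norm, norm_smul, norm_inv, norm_norm, inv_mul_cancel₀ hpos.ne']
      have hKw : K (A.symm (w b)) = dirMap A ⟨_, hunit⟩ := by
        rw [← hK ⟨_, hunit⟩ _ one_le, smul_inv_smul₀ hpos.ne']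
      have hcoord : (K (A.symm (w b))).1 i = ‖A.symm (w b)‖⁻¹ * (w b).1 i := by
        simp [hKw, dirMap]
      change (K (A.symm (w b))).1 i ≤ 0
      rw [hcoord, hwi, mul_neg_one, neg_nonpos]
      positivity
  have hnorm := (K (A.symm (w b))).2.2
  rw [(WithLp.ofLp_injective 2 hb : (K (A.symm (w b))).1 = 0), norm_zero] at hnorm
  exact zero_ne_one hnorm

end DirMap

section AvoidsMinima

variable {n : ℕ} {X : Type} [TopologicalSpace X] {F : Coalition n → Set X}
  {e : C(X, dirSphere (firm (n := n)))}

/-- At the points of `F S`, the minimum of the coordinates of `e` is not attained in `S`. This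
condition links a cover with an identification `e` of its domain with the sphere of directions, and
it makes `e` a representative of the maps associated with the cover. -/
def AvoidsMinima (e : C(X, dirSphere (firm (n := n)))) (F : Coalition n → Set X) : Prop :=
  ∀ S, ∀ x ∈ F S, ∀ i ∈ S.1, ∃ j, (e x).1 j < (e x).1 i

lemma AvoidsMinima.notMem_of_forall_le (h : AvoidsMinima e F) {x : X} {j : Fin n}
    (hj : ∀ i, (e x).1 j ≤ (e x).1 i) {S : Coalition n} (hS : x ∈ F S) : j ∉ S.1 := fun hjS =>
  let ⟨i, hi⟩ := h S x hS j hjS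
  hi.not_ge (hj i)

lemma AvoidsMinima.not_hasBalancedIntersection (h : AvoidsMinima e F) :
    ¬ HasBalancedIntersection F firm (bary n) := by
  rintro ⟨Φ, hΦ, x, hx⟩
  obtain ⟨j, hj⟩ := exists_forall_apply_le (e x)
  exact not_isConvRBalanced_of_forall_notMem
    (fun S hS => h.notMem_of_forall_le hj (mem_iInter₂.1 hx S hS)) hΦ

lemma normalize_apply_neg {u w : EuclideanSpace ℝ (Fin n)} (h : u = ‖w‖⁻¹ • w) {j : Fin n}
    (hw : w j < 0) : u j < 0 := by
  have hw₀ : w ≠ 0 := fun h₀ => hw.ne (by rw [h₀]; rfl)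
  rw [h, PiLp.smul_apply]
  exact mul_neg_of_pos_of_neg (inv_pos.2 (norm_pos_iff.2 hw₀)) hw

/-- The map `g` is compared with `e` through the map given by a partition of unity that is
subordinate both to the swelling of `F` used for `g` and to a cover for which `e` avoids minima. -/
theorem AvoidsMinima.homotopic [NeZero n] [NormalSpace X] (h : AvoidsMinima e F)
    (hcover : ⋃ S, F S = univ) {g : C(X, dirSphere firm)} (hg : IsCoverMap F firm (bary n) g) :
    e.Homotopic g := by
  classical
  obtain ⟨W, φ, hW, hFW, hnerve, hφ, hg⟩ := hg
  have isOpen_avoid (S : Coalition n) :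
      IsOpen {x | ∀ i ∈ S.1, ∃ j, (e x).1 j < (e x).1 i} := by
    simp only [Set.ofPred_forall, Set.ofPred_exists]
    exact isOpen_biInter_finset fun i _ => isOpen_iUnion fun j =>
      isOpen_lt (by fun_prop) (by fun_prop)
  obtain ⟨ψ, hψ⟩ := exists_partitionOfUnity_isSubordinate
    (fun S => (hW S).inter (isOpen_avoid S))
    (univ_subset_iff.1 (hcover.ge.trans (iUnion_mono fun S x hx => ⟨hFW S hx, h S x hx⟩)))
  have hψW : ψ.IsSubordinate W := fun S => (hψ S).trans inter_subset_left
  let g' := toDirSphere (offset ψ firm (bary n)) (offset_mem_vectorSpan ψ (bary_mem_affineSpan n))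
    fun x h₀ => h.not_hasBalancedIntersection
      (hasBalancedIntersection_of_offset_eq_zero hψW hnerve h₀)
  have he : e.Homotopic g' := homotopic_of_forall_exists_neg fun x => by
    obtain ⟨j, hj⟩ := exists_forall_apply_le (e x)
    refine ⟨j, apply_neg_of_forall_le _ hj, normalize_apply_neg rfl
      (offset_firm_apply_neg fun S hS hjS => ?_)⟩
    obtain ⟨i, hi⟩ := (mem_of_isSubordinate_of_ne_zero hψ hS).2 j hjS
    exact hi.not_ge (hj i)
  have hg' : g'.Homotopic g := homotopic_of_forall_exists_neg fun x => by
    obtain ⟨y, hy⟩ := (hnerve {S | x ∈ W S}).2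
      ⟨x, mem_iInter₂.2 fun S hS => (Finset.mem_filter.1 hS).2⟩
    obtain ⟨j, hj⟩ := exists_forall_apply_le (e y)
    have notMem (S : Coalition n) (hS : x ∈ W S) : j ∉ S.1 :=
      h.notMem_of_forall_le hj (mem_iInter₂.1 hy S (by simpa using hS))
    exact ⟨j,
      normalize_apply_neg rfl (offset_firm_apply_neg fun S hS =>
        notMem S (mem_of_isSubordinate_of_ne_zero hψW hS)),
      normalize_apply_neg (hg x) (offset_firm_apply_neg fun S hS =>
        notMem S (mem_of_isSubordinate_of_ne_zero hφ hS))⟩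
  exact he.trans hg'

variable [NeZero n] [NormalSpace X]

lemma AvoidsMinima.exists_isCoverMap (h : AvoidsMinima e F) (hF : ∀ S, IsClosed (F S))
    (hcover : ⋃ S, F S = univ) : ∃ g, IsCoverMap F firm (bary n) g :=
  exists_isCoverMap_of_not_hasBalancedIntersection (bary_mem_affineSpan n) hF hcover
    h.not_hasBalancedIntersection

theorem AvoidsMinima.hasCoverDegree (h : AvoidsMinima e F) (hF : ∀ S, IsClosed (F S))
    (hcover : ⋃ S, F S = univ) (m : ℕ) : HasCoverDegree F firm (bary n) e m 1 :=
  ⟨h.not_hasBalancedIntersection, h.exists_isCoverMap hF hcover, fun _ hg =>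
    hasDegree_one_of_homotopic m (h.homotopic hcover hg)⟩

theorem AvoidsMinima.isNontrivialCover (h : AvoidsMinima e F) (hF : ∀ S, IsClosed (F S))
    (hcover : ⋃ S, F S = univ) (he : ¬ e.Nullhomotopic) : IsNontrivialCover F firm (bary n) :=
  let ⟨g, hg⟩ := h.exists_isCoverMap hF hcover
  Or.inr ⟨g, hg, fun ⟨q, hq⟩ => he ⟨q, (h.homotopic hcover hg).trans hq⟩⟩

end AvoidsMinima

/-! ### The cover induced by a generalized game -/

namespace GenGame

variable {ι : Type} [Fintype ι] {n d : ℕ} (G : GenGame ι n d)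

lemma le_add_norm_sub (x y : Fin n → ℝ) : x ≤ y + ‖x - y‖ • (1 : Fin n → ℝ) := fun j => by
  have : x j - y j ≤ ‖x - y‖ := (le_abs_self _).trans (norm_le_pi_norm (x - y) j)
  simp only [Pi.add_apply, Pi.smul_apply, Pi.one_apply, smul_eq_mul, mul_one]
  linarith

lemma bddAbove_tau (x : Fin n → ℝ) : BddAbove {t : ℝ | x + t • 1 ∈ ⋃ i, G.U i} := by
  choose z hz using fun i => (ne_univ_iff_exists_notMem (G.U i)).1 (G.proper i)
  refine ⟨∑ i, ‖z i - x‖, fun t ht => ?_⟩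
  obtain ⟨i, hi⟩ := mem_iUnion.1 ht
  have lt_norm : t < ‖z i - x‖ := by
    by_contra! hle
    refine hz i (G.comprehensive i _ hi _ ((le_add_norm_sub _ x).trans ?_))
    gcongr
  exact lt_norm.le.trans (Finset.single_le_sum (f := fun i => ‖z i - x‖)
    (fun _ _ => norm_nonneg _) (Finset.mem_univ i))

lemma nonempty_tau [Nonempty ι] (x : Fin n → ℝ) :
    {t : ℝ | x + t • 1 ∈ ⋃ i, G.U i}.Nonempty := by
  obtain ⟨i⟩ := ‹Nonempty ι›
  obtain ⟨w, hw⟩ := G.nonempty i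
  refine ⟨-‖x - w‖, mem_iUnion.2 ⟨i, G.comprehensive i _ hw _ ?_⟩⟩
  rw [neg_smul, ← sub_eq_add_neg, sub_le_iff_le_add]
  exact le_add_norm_sub x w

lemma le_tau {x : Fin n → ℝ} {t : ℝ} {i : ι} (h : x + t • 1 ∈ G.U i) : t ≤ G.tau x :=
  le_csSup (G.bddAbove_tau x) (mem_iUnion.2 ⟨i, h⟩)

lemma add_tau_notMem_interior (x : Fin n → ℝ) (i : ι) :
    x + G.tau x • 1 ∉ interior (G.U i) := by
  intro h
  have hc : ContinuousAt (fun t : ℝ => x + t • (1 : Fin n → ℝ)) (G.tau x) := by fun_prop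
  obtain ⟨t, ht, htU⟩ := (hc.eventually (mem_interior_iff_mem_nhds.1 h)).exists_gt
  exact ht.not_ge (G.le_tau htU)

section Nonempty

variable [Nonempty ι]

lemma iUnion_cover : ⋃ i, G.cover i = univ := by
  refine eq_univ_of_forall fun x => ?_
  have hclosed : IsClosed {t : ℝ | x + t • 1 ∈ ⋃ i, G.U i} :=
    (isClosed_iUnion_of_finite G.closed).preimage
      (f := fun t : ℝ => x + t • (1 : Fin n → ℝ)) (by fun_prop)
  obtain ⟨i, hi⟩ := mem_iUnion.1 (hclosed.csSup_mem (G.nonempty_tau x) (G.bddAbove_tau x))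
  exact mem_iUnion.2 ⟨i, hi⟩

lemma continuous_tau : Continuous G.tau := by
  refine (LipschitzWith.of_le_add fun x y => ?_).continuous
  obtain ⟨i, hi⟩ := iUnion_eq_univ_iff.1 G.iUnion_cover x
  suffices G.tau x - dist x y ≤ G.tau y by linarith
  refine G.le_tau (G.comprehensive i _ hi _ ?_)
  rw [sub_smul, add_sub, sub_le_iff_le_add, add_right_comm, dist_comm, dist_eq_norm]
  gcongr
  exact le_add_norm_sub y x

lemma isClosed_cover (i : ι) : IsClosed (G.cover i) :=
  (G.closed i).preimage (by have := G.continuous_tau; fun_prop)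

end Nonempty

theorem fractionalCore_nonempty_of_isRBalanced {Φ : Finset ι} (hΦ : IsRBalanced G.v G.r Φ)
    (h : (⋂ i ∈ Φ, G.cover i).Nonempty) : G.fractionalCore.Nonempty := by
  obtain ⟨lam, hlam⟩ := hΦ
  obtain ⟨p, hp⟩ := h
  exact ⟨p + G.tau p • 1, ⟨Φ, lam, hlam, fun i hi _ => mem_iInter₂.1 hp i hi⟩,
    G.add_tau_notMem_interior p⟩

end GenGame

/-! ### Covers of the simplex -/

section Simplex

variable {n : ℕ} {M : ℝ} {T : Finset (Fin n)} {p : Fin n → ℝ}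

lemma face_subset_simplex (M : ℝ) (T : Finset (Fin n)) : face M T ⊆ simplex n M :=
  convexHull_mono (image_mono fun i _ => Finset.mem_univ i)

lemma isCompact_face (M : ℝ) (T : Finset (Fin n)) : IsCompact (face M T) :=
  (T.finite_toSet.image _).isCompact_convexHull ℝ

lemma apply_eq_zero_of_mem_face (hp : p ∈ face M T) {j : Fin n} (hj : j ∉ T) : p j = 0 := by
  refine convexHull_min ?_ ((convex_singleton (0 : ℝ)).linear_preimage
    (LinearMap.proj j : (Fin n → ℝ) →ₗ[ℝ] ℝ)) hp
  rintro _ ⟨i, hi, rfl⟩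
  exact Pi.single_eq_of_ne (ne_of_mem_of_not_mem hi hj).symm _

lemma sum_eq_of_mem_simplex (hp : p ∈ simplex n M) : ∑ i, p i = -M := by
  have : p ∈ (∑ i, LinearMap.proj i : (Fin n → ℝ) →ₗ[ℝ] ℝ) ⁻¹' {-M} := by
    refine convexHull_min ?_ ((convex_singleton (-M)).linear_preimage _) hp
    rintro _ ⟨i, -, rfl⟩
    simp
  simpa using this

lemma neg_smul_mem_simplex {b : Fin n → ℝ} (hb : b ∈ stdSimplex ℝ (Fin n)) :
    -M • b ∈ simplex n M := by
  have hsum : -M • b = ∑ i, b i • (Pi.single i (-M) : Fin n → ℝ) := by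
    ext j
    simp [Finset.sum_apply, Pi.single_apply, mul_comm]
  rw [hsum]
  exact (convex_convexHull ℝ _).sum_mem (fun i _ => hb.1 i) hb.2 fun i _ =>
    subset_convexHull ℝ _ ⟨i, Finset.mem_univ i, rfl⟩

lemma radial_apply_lt_radial_apply (hM : 0 < M) (q : boundary n M) {i j : Fin n}
    (hij : q.1 i < q.1 j) : (radial n M hM q).1 j < (radial n M hM q).1 i := by
  have hpos : 0 < ‖bar M q.1 - bary n‖⁻¹ := inv_pos.2 (norm_pos_iff.2 (bar_mem hM q.2).1)
  have hbar : bar M q.1 j < bar M q.1 i := mul_lt_mul_of_neg_left hij (by simpa using hM)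
  exact mul_lt_mul_of_pos_left (sub_lt_sub_right hbar _) hpos

variable {F : Coalition n → Set (Fin n → ℝ)} (hF : ∀ S, IsClosed (F S))
  (hcover : ⋃ S, F S = univ) (hneg : ∀ p ∈ simplex n M, ∀ S, p ∈ F S → ∀ i ∈ S.1, p i < 0)

include hF hcover hneg

theorem isKKMSCover_of_forall_apply_neg : IsKKMSCover M F := by
  refine ⟨fun S => (hF S).inter (isCompact_face M Finset.univ).isClosed, fun T p hp => ?_⟩
  obtain ⟨S, hS⟩ := iUnion_eq_univ_iff.1 hcover p
  refine mem_iUnion.2 ⟨⟨S, fun i hi => ?_⟩, hS⟩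
  by_contra hiT
  exact (hneg p (face_subset_simplex M _ hp) S hS i hi).ne (apply_eq_zero_of_mem_face hp hiT)

variable [NeZero n]

theorem hasCoverDegree_boundary (hM : 0 < M) (m : ℕ) :
    HasCoverDegree (fun S => {q : boundary n M | (q : Fin n → ℝ) ∈ F S}) firm (bary n)
      (radial n M hM) m 1 := by
  have avoids : AvoidsMinima (radial n M hM) fun S => {q : boundary n M | q.1 ∈ F S} := by
    intro S q hq i hi
    obtain ⟨⟨T, hT⟩, hqT⟩ := mem_iUnion.1 q.2
    obtain ⟨j, hj⟩ := not_forall.1 (mt Finset.eq_univ_of_forall hT)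
    have hqi := hneg q (face_subset_simplex M T hqT) S hq i hi
    exact ⟨j, radial_apply_lt_radial_apply hM q
      (hqi.trans_eq (apply_eq_zero_of_mem_face hqT hj).symm)⟩
  exact avoids.hasCoverDegree (fun S => (hF S).preimage continuous_subtype_val)
    (iUnion_eq_univ_iff.2 fun q => iUnion_eq_univ_iff.1 hcover q) m

theorem exists_isRBalanced_simplex_inter_nonempty : ∃ Φ : Finset (Coalition n),
    IsRBalanced firm (bary n) Φ ∧ (simplex n M ∩ ⋂ S ∈ Φ, F S).Nonempty := by
  obtain ⟨Φ, hΦ, b, hb⟩ := hasBalancedIntersection_of_stdSimplex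
    (F := fun S => {b | -M • b.1 ∈ F S})
    (fun S => (hF S).preimage (by fun_prop))
    (iUnion_eq_univ_iff.2 fun b => iUnion_eq_univ_iff.1 hcover (-M • b.1))
    fun S b hb i hi hbi => by
      have := hneg _ (neg_smul_mem_simplex b.2) S hb i hi
      exact this.ne (mul_eq_zero_of_right (-M) hbi)
  exact ⟨Φ, hΦ.isRBalanced, -M • b.1, neg_smul_mem_simplex b.2,
    mem_iInter₂.2 fun S hS => mem_iInter₂.1 hb S hS⟩

end Simplex

/-! ### The game attached to an NTU game -/

instance nonempty_coalition {n : ℕ} [NeZero n] : Nonempty (Coalition n) := ⟨single 0⟩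

namespace NTUGame

variable {n : ℕ} (hn : 0 < n) (N : NTUGame n)

lemma apply_le_add_tau (p : Fin n → ℝ) {i : Fin n} {y : (single i).1 → ℝ}
    (hy : y ∈ N.V (single i)) (k : (single i).1) : y k ≤ p i + (N.toGen hn).tau p := by
  rw [← sub_le_iff_le_add']
  refine (N.toGen hn).le_tau (i := single i) (N.comprehensive _ y hy _ fun l => ?_)
  have hl : l.1 = i := Finset.mem_singleton.1 l.2
  have hk : k = l := Subtype.ext ((Finset.mem_singleton.1 k.2).trans hl.symm)
  simp [hl, hk]

/-- The point `p + tau p • 1` is individually rational, so that its coordinates are bounded below,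
and those in `S` are bounded above if `p` is in the member `S` of the cover. Both bounds refer to
differences of coordinates of `p` only. -/
theorem exists_mul_sub_sum_lt : ∃ L, 0 < L ∧ ∀ p S, p ∈ (N.toGen hn).cover S →
    ∀ i ∈ S.1, n * p i - ∑ j, p j < L := by
  choose B hB using N.bounded
  choose a ha using fun j => N.nonempty (single j)
  let k (j : Fin n) : (single j).1 := ⟨j, Finset.mem_singleton_self j⟩
  refine ⟨∑ S, |n * B S - ∑ j, a j (k j)| + 1, by positivity, fun p S hp i hi => ?_⟩
  have rational (j : Fin n) : a j (k j) ≤ p j + (N.toGen hn).tau p :=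
    N.apply_le_add_tau hn p (ha j) (k j)
  have upper : p i + (N.toGen hn).tau p < B S := by
    simpa using hB S _ hp
      (fun l y hy m => by simpa using N.apply_le_add_tau hn p hy m) ⟨i, hi⟩
  have lower : ∑ j, a j (k j) ≤ ∑ j, p j + n * (N.toGen hn).tau p := by
    simpa [Finset.sum_add_distrib] using Finset.sum_le_sum fun j (_ : j ∈ Finset.univ) => rational j
  calc n * p i - ∑ j, p j
      ≤ n * (p i + (N.toGen hn).tau p) - ∑ j, a j (k j) := by linarith
    _ ≤ n * B S - ∑ j, a j (k j) := by gcongr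
    _ ≤ |n * B S - ∑ j, a j (k j)| := le_abs_self _
    _ ≤ ∑ S, |n * B S - ∑ j, a j (k j)| :=
        Finset.single_le_sum (f := fun S => |n * B S - ∑ j, a j (k j)|)
          (fun _ _ => abs_nonneg _) (Finset.mem_univ S)
    _ < _ := lt_add_one _

lemma exists_forall_mem_simplex_apply_neg : ∃ M₀, ∀ M, M₀ ≤ M → ∀ p ∈ simplex n M, ∀ S,
    p ∈ (N.toGen hn).cover S → ∀ i ∈ S.1, p i < 0 := by
  obtain ⟨L, -, h⟩ := N.exists_mul_sub_sum_lt hn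
  refine ⟨L, fun M hM p hp S hS i hi => ?_⟩
  have hlt := h p S hS i hi
  rw [sum_eq_of_mem_simplex hp] at hlt
  by_contra! hpi
  have : 0 ≤ n * p i := by positivity
  linarith

lemma one_le_finrank_vectorSpan_firm (h2 : 2 ≤ n) :
    1 ≤ Module.finrank ℝ (vectorSpan ℝ (range (firm (n := n)))) := by
  have hne : firm (single (⟨0, by omega⟩ : Fin n)) ≠ firm (single ⟨1, h2⟩) := by
    intro h
    have := congrArg (fun u : EuclideanSpace ℝ (Fin n) => u ⟨0, by omega⟩) h
    simp [firm_single] at this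
  have : Nontrivial (vectorSpan ℝ (range (firm (n := n)))) :=
    (Submodule.nontrivial_iff_ne_bot).2 fun hbot => hne <|
      (vectorSpan_eq_bot_iff_subsingleton ℝ).1 hbot (mem_range_self _) (mem_range_self _)
  exact Module.finrank_pos

/-- The hyperplane is parametrized by `f y = -R • A y` for a linear isometry `A`. On a large sphere,
the minimum of the coordinates of `A y` cannot be attained in `S` if `f y` is in the member `S` of
the cover, so that the cover is represented by `dirMap A`. -/
theorem coverNontrivial_toGen_of_two_le (h2 : 2 ≤ n) : (N.toGen hn).CoverNontrivial := by
  have : NeZero n := ⟨hn.ne'⟩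
  obtain ⟨L, hL, hsub⟩ := N.exists_mul_sub_sum_lt hn
  let D := vectorSpan ℝ (range (firm (n := n)))
  let k := Module.finrank ℝ D
  let A : EuclideanSpace ℝ (Fin k) ≃ₗᵢ[ℝ] D :=
    (stdOrthonormalBasis ℝ D).repr.symm
  have hf (y : EuclideanSpace ℝ (Fin k)) : ∑ i, (-L • (A y).1.ofLp) i = 0 := by
    simp [← Finset.mul_sum, mem_vectorSpan_firm_iff.1 (A y).2]
  let f : C(closedBall (0 : EuclideanSpace ℝ (Fin k)) 1,
      {x : Fin n → ℝ // ∑ i, x i = 0}) :=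
    ⟨fun y => ⟨-L • (A y).1.ofLp, hf y⟩, by fun_prop⟩
  have avoids : AvoidsMinima (dirMap A) fun S =>
      {y : sphere (0 : EuclideanSpace ℝ (Fin k)) 1 |
        (f ⟨y, sphere_subset_closedBall y.2⟩ : Fin n → ℝ) ∈ (N.toGen hn).cover S} := by
    intro S y hy i hi
    by_contra! hmin
    have hlt : n * (-L * (dirMap A y).1 i) < L := by
      have := hsub _ S hy i hi
      rwa [(f _).2, sub_zero] at this
    nlinarith [nat_mul_apply_le_neg_one (dirMap A y) hmin]
  refine ⟨k, f, one_le_finrank_vectorSpan_firm h2, avoids.isNontrivialCover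
    (fun S => ((N.toGen hn).isClosed_cover S).preimage (by fun_prop))
    (iUnion_eq_univ_iff.2 fun y => iUnion_eq_univ_iff.1 (N.toGen hn).iUnion_cover _)
    (not_nullhomotopic_dirMap A)⟩

lemma coverNontrivial_toGen_one (N : NTUGame 1) : (N.toGen one_pos).CoverNontrivial := by
  obtain ⟨S, hS⟩ := iUnion_eq_univ_iff.1 (N.toGen one_pos).iUnion_cover 0
  obtain rfl : S = grand one_pos := by
    obtain ⟨i, hi⟩ := S.2
    exact Subtype.ext (Finset.eq_univ_of_forall fun j => Subsingleton.elim i j ▸ hi)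
  obtain ⟨y, hy⟩ := (NormedSpace.sphere_nonempty (x := (0 : EuclideanSpace ℝ (Fin 1)))).2
    zero_le_one
  refine ⟨1, .const _ ⟨0, by simp⟩, le_rfl, Or.inl ⟨{grand one_pos}, ?_, ⟨y, hy⟩, ?_⟩⟩
  · exact subset_convexHull ℝ _ ⟨_, by simp, firm_grand one_pos⟩
  · simpa using hS

theorem homotopicallyNontrivial_toGen : (N.toGen hn).HomotopicallyNontrivial := by
  have : NeZero n := ⟨hn.ne'⟩
  refine ⟨n, N.toGen hn, ⟨fun _ => rfl, fun _ => Iff.rfl⟩, isConvexPair_firm_bary n, ?_⟩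
  obtain rfl | h2 := (Nat.succ_le_iff.2 hn).eq_or_lt
  · exact N.coverNontrivial_toGen_one
  · exact N.coverNontrivial_toGen_of_two_le hn h2

end NTUGame

/-! ### Fractional cores -/

lemma nat_mul_inv_card_pos {n : ℕ} (S : Coalition n) : 0 < n * (S.1.card : ℝ)⁻¹ := by
  have hS : 0 < S.1.card := S.2.card_pos
  have hn : 0 < n := S.2.choose.pos
  positivity

lemma isWeights_iff_isBalancingWeights {n : ℕ} (hn : 0 < n) {Φ : Finset (Coalition n)}
    {lam : Coalition n → ℝ} :
    IsWeights firm (bary n) Φ lam ↔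
      IsBalancingWeights Φ fun S => n * (S.1.card : ℝ)⁻¹ * lam S := by
  have hn₀ : (n : ℝ) ≠ 0 := Nat.cast_ne_zero.2 hn.ne'
  have hfirm : ∑ S ∈ Φ, (n * (S.1.card : ℝ)⁻¹ * lam S) • (S.1 : Set (Fin n)).indicator 1 =
      (n : ℝ) • (∑ S ∈ Φ, lam S • firm S).ofLp := by
    ext i
    simp only [WithLp.ofLp_sum, WithLp.ofLp_smul, Finset.sum_apply, Pi.smul_apply, smul_eq_mul,
      Finset.mul_sum]
    refine Finset.sum_congr rfl fun S _ => ?_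
    by_cases hi : i ∈ S.1
    · simp [firm, hi]
      ring
    · simp [firm, hi]
  have hbary : (n : ℝ) • (bary n).ofLp = 1 := by
    ext i
    simp [bary, hn₀]
  refine and_congr (forall₂_congr fun S _ => ?_) ?_
  · exact (mul_nonneg_iff_of_pos_left (nat_mul_inv_card_pos S)).symm
  · rw [hfirm, ← hbary, (smul_right_injective (Fin n → ℝ) hn₀).eq_iff]
    exact (WithLp.ofLp_injective 2).eq_iff.symm

theorem fractionalCore_toGen {n : ℕ} (hn : 0 < n) (N : NTUGame n) :
    (N.toGen hn).fractionalCore = N.fractionalCore := by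
  ext x
  refine and_congr ⟨?_, ?_⟩ Iff.rfl
  · rintro ⟨Φ, lam, hlam, hx⟩
    exact ⟨Φ, _, (isWeights_iff_isBalancingWeights hn).1 hlam, fun S hS h =>
      hx S hS ((mul_pos_iff_of_pos_left (nat_mul_inv_card_pos S)).1 h)⟩
  · rintro ⟨Φ, lam, hlam, hx⟩
    refine ⟨Φ, fun S => (n * (S.1.card : ℝ)⁻¹)⁻¹ * lam S,
      (isWeights_iff_isBalancingWeights hn).2 ?_, fun S hS h =>
      hx S hS ((mul_pos_iff_of_pos_left (inv_pos.2 (nat_mul_inv_card_pos S))).1 h)⟩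
    simpa only [mul_inv_cancel_left₀ (nat_mul_inv_card_pos _).ne'] using hlam

theorem NTUGame.core_nonempty_of_isBalanced {n : ℕ} (hn : 0 < n) (N : NTUGame n)
    (hN : N.IsBalanced hn) (h : N.fractionalCore.Nonempty) : (N.core hn).Nonempty := by
  classical
  obtain ⟨x, ⟨Φ, lam, ⟨hlam, hsum⟩, hx⟩, hint⟩ := h
  have hpos : IsBalancedFamily {S ∈ Φ | 0 < lam S} := by
    refine ⟨lam, fun S hS => (Finset.mem_filter.1 hS).2.le, ?_⟩
    refine (Finset.sum_filter_of_ne fun S hS hne => ?_).trans hsum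
    exact (hlam S hS).lt_of_ne fun h₀ => hne (by rw [← h₀, zero_smul])
  refine ⟨x, hN _ hpos (mem_iInter₂.2 fun S hS => ?_), by simpa using hint⟩
  exact hx S (Finset.mem_filter.1 hS).1 (Finset.mem_filter.1 hS).2

end ScarfGame

open ScarfGame in
theorem mainTheorem8 (n : ℕ) (hn : 0 < n) (N : NTUGame n) :
    (∃ M₀ : ℝ, ∀ (M : ℝ) (hM : 0 < M), M₀ ≤ M →
      IsKKMSCover M (N.toGen hn).cover ∧
      (2 ≤ n → HasCoverDegree
        (fun S : Coalition n => {p : boundary n M | (p : Fin n → ℝ) ∈ (N.toGen hn).cover S})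
        (N.toGen hn).v (N.toGen hn).r (radial n M hM) (n - 2) 1) ∧
      ∃ S : Finset (Coalition n), IsRBalanced (N.toGen hn).v (N.toGen hn).r S ∧
        (simplex n M ∩ ⋂ T ∈ S, (N.toGen hn).cover T).Nonempty) ∧
    IsConvexPair (N.toGen hn).v (N.toGen hn).r ∧
    (N.toGen hn).HomotopicallyNontrivial ∧
    (N.toGen hn).fractionalCore.Nonempty ∧
    (N.toGen hn).fractionalCore = N.fractionalCore ∧
    (N.IsBalanced hn → (N.core hn).Nonempty) := by
  have : NeZero n := ⟨hn.ne'⟩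
  have hclosed := (N.toGen hn).isClosed_cover
  have hcover := (N.toGen hn).iUnion_cover
  obtain ⟨M₀, hneg⟩ := N.exists_forall_mem_simplex_apply_neg hn
  have hbal (M : ℝ) (hM : M₀ ≤ M) :=
    exists_isRBalanced_simplex_inter_nonempty hclosed hcover (hneg M hM)
  have hcore : (N.toGen hn).fractionalCore.Nonempty := by
    obtain ⟨Φ, hΦ, hne⟩ := hbal M₀ le_rfl
    exact (N.toGen hn).fractionalCore_nonempty_of_isRBalanced hΦ (hne.mono inter_subset_right)
  refine ⟨⟨M₀, fun M hM hM₀ => ⟨?_, fun _ => ?_, hbal M hM₀⟩⟩, isConvexPair_firm_bary n,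
    N.homotopicallyNontrivial_toGen hn, hcore, fractionalCore_toGen hn N, fun hN => ?_⟩
  · exact isKKMSCover_of_forall_apply_neg hclosed hcover (hneg M hM₀)
  · exact hasCoverDegree_boundary hclosed hcover (hneg M hM₀) hM (n - 2)
  · exact N.core_nonempty_of_isBalanced hn hN (fractionalCore_toGen hn N ▸ hcore)
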